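/- **Proposition 3.2.** Let $V=\mathbb{R}^8$ with its standard metric and orthonormal basis, and let $\Theta\in\Lambda^4V$ be the four-form whose components are $\Theta_{ijkl}=1$ for $$(ijkl)=(1245),(1276),(1346),(1357),(2356),(2437),(4567),(1238),(4358),(4718),(5168),(5728),(6248),(6738),$$ extended by total antisymmetry, all remaining components being zero. Let $\mathfrak{spin}(7)\subset\mathfrak{so}(8)$ be the stabilizer subalgebra of $\Theta$, i.e. the Lie algebra of all skew-symmetric matrices whose infinitesimal action on forms annihilates $\Theta$. Define the duality operator $b_\Theta:\Lambda^3V\to\Lambda^3V$ by $$b_\Theta(F)_{lmn}=\Theta_{ij[lm}F^{ij}{}_{n]},\qquad\text{i.e. } (b_\Theta)_{lmn}{}^{ijk}=\Theta_{[lm}{}^{[ij}\delta_{n]}^{k]},$$ where repeated indices are summed from $1$ to $8$ and $[\cdots]$ denotes antisymmetrization with weight one (the signed average over all permutations). Then $$(b_\Theta)^2=\tfrac{8}{3}\,\mathrm{id}-\tfrac{10}{3}\,b_\Theta .$$ The operator $b_\Theta$ is of order two, i.e. it has exactly two distinct eigenvalues, and it is perfect: $\Theta$ is invariant under $\mathfrak{spin}(7)\subset\mathfrak{so}(8)$,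 and the number of distinct eigenvalues of $b_\Theta$ equals the number of irreducible summands in a decomposition of $\Lambda^3V$ into irreducible $\mathfrak{spin}(7)$-submodules. The eigenvalues are exactly $-4$ and $\frac23$. The eigenspace for $-4$ has dimension $8$, the eigenspace for $\frac23$ has dimension $48$, $\Lambda^3V$ is their direct sum, and they are exactly the irreducible $\mathfrak{spin}(7)$-submodules of $\Lambda^3V$. -/

import Mathlib

attribute [local instance 100] LieRing.ofAssociativeRing

namespace SpinSevenDuality

/-- `Form n k` is `Λᵏ ℝⁿ`, realized as the space of alternating `k`-linear forms on `ℝⁿ`. The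
components of `F` are `F_{i₁ … iₖ} = F (e_{i₁}, …, e_{iₖ})` for the standard basis `e` of `ℝⁿ`,
which is orthonormal, so that indices may be raised and lowered freely. -/
abbrev Form (n k : ℕ) : Type := (Fin n → ℝ) [⋀^Fin k]→ₗ[ℝ] ℝ

/-- The standard basis vector `e_i` of `ℝⁿ`. -/
abbrev e {n : ℕ} (i : Fin n) : Fin n → ℝ := Pi.single i 1

/-! ### The action of matrices on forms -/

/-- The infinitesimal action of a matrix `A` on forms:
`(A · F)(v₁, …, vₖ) = - ∑ᵢ F(v₁, …, A vᵢ, …, vₖ)`. -/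
def matrixAction {n k : ℕ} (A : Matrix (Fin n) (Fin n) ℝ) (F : Form n k) : Form n k :=
  { toFun := fun v => - ∑ i, F (Function.update v i (A.mulVec (v i)))
    map_update_add' := by
      intro inst v i x y
      obtain rfl : inst = instDecidableEqFin k := Subsingleton.elim _ _
      rw [← neg_add, ← Finset.sum_add_distrib]
      congr 1
      refine Finset.sum_congr rfl fun j _ => ?_
      by_cases h : j = i
      · subst h
        simp [Matrix.mulVec_add]
      · simp only [Function.update_of_ne h]
        rw [Function.update_comm (Ne.symm h), Function.update_comm (Ne.symm h),
          Function.update_comm (Ne.symm h)]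
        simp
    map_update_smul' := by
      intro inst v i c x
      obtain rfl : inst = instDecidableEqFin k := Subsingleton.elim _ _
      rw [smul_neg, Finset.smul_sum]
      congr 1
      refine Finset.sum_congr rfl fun j _ => ?_
      by_cases h : j = i
      · subst h
        simp [Matrix.mulVec_smul]
      · simp only [Function.update_of_ne h]
        rw [Function.update_comm (Ne.symm h), Function.update_comm (Ne.symm h)]
        simp
    map_eq_zero_of_eq' := by
      intro v i j hv hij
      rw [neg_eq_zero]
      rw [← Finset.sum_subset (Finset.subset_univ {i, j}), Finset.sum_pair hij]
      · have : Function.update v j (A.mulVec (v j))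
            = Function.update v i (A.mulVec (v i)) ∘ Equiv.swap i j := by
          funext l
          rcases eq_or_ne l i with rfl | hi
          · simp [Function.update_of_ne hij, Function.update_of_ne hij.symm, hv]
          rcases eq_or_ne l j with rfl | hj
          · simp [hv]
          · simp [Function.update_of_ne hi, Function.update_of_ne hj,
              Equiv.swap_apply_of_ne_of_ne hi hj]
        rw [this, F.map_swap _ hij, add_neg_cancel]
      · intro l _ hl
        simp only [Finset.mem_insert, Finset.mem_singleton, not_or] at hl
        refine F.map_eq_zero_of_eq _ (i := i) (j := j) ?_ hij
        rw [Function.update_of_ne (Ne.symm hl.1), Function.update_of_ne (Ne.symm hl.2), hv] }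

theorem matrixAction_apply {n k : ℕ} (A : Matrix (Fin n) (Fin n) ℝ) (F : Form n k)
    (v : Fin k → Fin n → ℝ) :
    matrixAction A F v = - ∑ i, F (Function.update v i (A.mulVec (v i))) := rfl

/-- Applying `B` and then `A`, the terms with both matrices on the same slot separated. -/
theorem matrixAction_comp_apply {n k : ℕ} (A B : Matrix (Fin n) (Fin n) ℝ) (F : Form n k)
    (v : Fin k → Fin n → ℝ) :
    matrixAction A (matrixAction B F) v
      = ∑ i, F (Function.update v i ((B * A).mulVec (v i)))
        + ∑ i, ∑ j ∈ Finset.univ.erase i,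
          F (Function.update (Function.update v i (A.mulVec (v i))) j (B.mulVec (v j))) := by
  simp only [matrixAction_apply, Finset.sum_neg_distrib, neg_neg]
  rw [← Finset.sum_add_distrib]
  refine Finset.sum_congr rfl fun i _ => ?_
  rw [← Finset.add_sum_erase _ _ (Finset.mem_univ i)]
  congr 1
  · simp [Matrix.mulVec_mulVec]
  · refine Finset.sum_congr rfl fun j hj => ?_
    rw [Function.update_of_ne (Finset.ne_of_mem_erase hj)]

theorem matrixAction_bracket {n k : ℕ} (A B : Matrix (Fin n) (Fin n) ℝ) (F : Form n k) :
    matrixAction A (matrixAction B F)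
      = matrixAction ⁅A, B⁆ F + matrixAction B (matrixAction A F) := by
  ext v
  rw [AlternatingMap.add_apply, matrixAction_comp_apply, matrixAction_comp_apply,
    matrixAction_apply]
  have h : ∑ i, ∑ j ∈ Finset.univ.erase i,
        F (Function.update (Function.update v i (A.mulVec (v i))) j (B.mulVec (v j)))
      = ∑ i, ∑ j ∈ Finset.univ.erase i,
        F (Function.update (Function.update v i (B.mulVec (v i))) j (A.mulVec (v j))) := by
    rw [Finset.sum_comm' (t' := Finset.univ) (s' := fun j => Finset.univ.erase j)
      (by intro x y; simp [eq_comm])]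
    refine Finset.sum_congr rfl fun i _ => Finset.sum_congr rfl fun j hj => ?_
    rw [Function.update_comm (Finset.ne_of_mem_erase hj)]
  rw [h, ← add_assoc]
  congr 1
  rw [Ring.lie_def]
  simp only [Matrix.sub_mulVec, AlternatingMap.map_update_sub, Finset.sum_sub_distrib]
  ring

/-- The natural representation of the Lie algebra `𝔤𝔩(n)` on `Λᵏ ℝⁿ`. -/
instance (n k : ℕ) : LieRingModule (Matrix (Fin n) (Fin n) ℝ) (Form n k) where
  bracket := matrixAction
  add_lie A B F := by
    ext v
    simp only [matrixAction_apply, AlternatingMap.add_apply, Matrix.add_mulVec,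
      AlternatingMap.map_update_add, Finset.sum_add_distrib, neg_add]
  lie_add A F G := by
    ext v
    simp only [matrixAction_apply, AlternatingMap.add_apply, Finset.sum_add_distrib, neg_add]
  leibniz_lie := matrixAction_bracket

instance (n k : ℕ) : LieModule ℝ (Matrix (Fin n) (Fin n) ℝ) (Form n k) where
  smul_lie c A F := by
    change matrixAction (c • A) F = c • matrixAction A F
    ext v
    simp only [matrixAction_apply, AlternatingMap.smul_apply, Matrix.smul_mulVec,
      AlternatingMap.map_update_smul, ← Finset.smul_sum, smul_neg]
  lie_smul c A F := by
    change matrixAction A (c • F) = c • matrixAction A F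
    ext v
    simp only [matrixAction_apply, AlternatingMap.smul_apply, ← Finset.smul_sum, smul_neg]

/-- The Lie subalgebra of `𝔰𝔬(n)` of all skew-symmetric matrices that annihilate the form `Ω`. -/
def stabilizer {n l : ℕ} (Ω : Form n l) : LieSubalgebra ℝ (Matrix (Fin n) (Fin n) ℝ) where
  carrier := {A | A ∈ LieAlgebra.Orthogonal.so (Fin n) ℝ ∧ ⁅A, Ω⁆ = 0}
  add_mem' := fun ha hb => ⟨add_mem ha.1 hb.1, by rw [add_lie, ha.2, hb.2, add_zero]⟩
  zero_mem' := ⟨zero_mem _, zero_lie _⟩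
  smul_mem' := fun c _ ha => ⟨(LieAlgebra.Orthogonal.so (Fin n) ℝ).smul_mem c ha.1, by
    rw [smul_lie, ha.2, smul_zero]⟩
  lie_mem' := fun ha hb => ⟨LieSubalgebra.lie_mem _ ha.1 hb.1, by
    rw [lie_lie, ha.2, hb.2, lie_zero, lie_zero, sub_zero]⟩

/-! ### The duality operator of a four-form on three-forms -/

/-- The tensor `(x, y, z) ↦ ∑ i j, Ω(e_i, e_j, x, y) F(e_i, e_j, z)`, with components
`Ω_{ijlm} F^{ij}{}_n`. -/
def contraction {n : ℕ} (Ω : Form n 4) (F : Form n 3) :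
    MultilinearMap ℝ (fun _ : Fin 3 => Fin n → ℝ) ℝ :=
  { toFun := fun v => ∑ i, ∑ j, Ω ![e i, e j, v 0, v 1] * F ![e i, e j, v 2]
    map_update_add' := by
      intro inst v l x y
      obtain rfl : inst = instDecidableEqFin 3 := Subsingleton.elim _ _
      simp only [← Finset.sum_add_distrib]
      refine Finset.sum_congr rfl fun i _ => Finset.sum_congr rfl fun j _ => ?_
      have h0 := Ω.map_update_add ![e i, e j, 0, v 1] 2 x y
      have h1 := Ω.map_update_add ![e i, e j, v 0, 0] 3 x y
      have h2 := F.map_update_add ![e i, e j, 0] 2 x y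
      have u0 (z : Fin n → ℝ) :
          Function.update ![e i, e j, 0, v 1] 2 z = ![e i, e j, z, v 1] := by
        ext a; fin_cases a <;> rfl
      have u1 (z : Fin n → ℝ) :
          Function.update ![e i, e j, v 0, 0] 3 z = ![e i, e j, v 0, z] := by
        ext a; fin_cases a <;> rfl
      have u2 (z : Fin n → ℝ) : Function.update ![e i, e j, 0] 2 z = ![e i, e j, z] := by
        ext a; fin_cases a <;> rfl
      rw [u0, u0, u0] at h0
      rw [u1, u1, u1] at h1
      rw [u2, u2, u2] at h2
      fin_cases l
      · simp [h0, add_mul]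
      · simp [h1, add_mul]
      · simp [h2, mul_add]
    map_update_smul' := by
      intro inst v l c x
      obtain rfl : inst = instDecidableEqFin 3 := Subsingleton.elim _ _
      simp only [Finset.smul_sum]
      refine Finset.sum_congr rfl fun i _ => Finset.sum_congr rfl fun j _ => ?_
      have h0 := Ω.map_update_smul ![e i, e j, 0, v 1] 2 c x
      have h1 := Ω.map_update_smul ![e i, e j, v 0, 0] 3 c x
      have h2 := F.map_update_smul ![e i, e j, 0] 2 c x
      have u0 (z : Fin n → ℝ) :
          Function.update ![e i, e j, 0, v 1] 2 z = ![e i, e j, z, v 1] := by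
        ext a; fin_cases a <;> rfl
      have u1 (z : Fin n → ℝ) :
          Function.update ![e i, e j, v 0, 0] 3 z = ![e i, e j, v 0, z] := by
        ext a; fin_cases a <;> rfl
      have u2 (z : Fin n → ℝ) : Function.update ![e i, e j, 0] 2 z = ![e i, e j, z] := by
        ext a; fin_cases a <;> rfl
      rw [u0, u0] at h0
      rw [u1, u1] at h1
      rw [u2, u2] at h2
      fin_cases l
      · simp [h0, mul_assoc]
      · simp [h1, mul_assoc]
      · simp [h2, mul_left_comm] }

/-- The duality operator `b_Ω : Λ³ ℝⁿ → Λ³ ℝⁿ` of a four-form `Ω`,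
`b_Ω(F)_{lmn} = Ω_{ij[lm} F^{ij}{}_{n]}`, that is, the operator with the components
`(b_Ω)_{lmn}{}^{ijk} = Ω_{[lm}{}^{[ij} δ_{n]}{}^{k]}`.
Here `[⋯]` is antisymmetrization with weight one: the sum over all permutations with signs, divided
by `3!`. All repeated indices are summed from `1` to `n`. -/
noncomputable def dualityOperator {n : ℕ} (Ω : Form n 4) : Module.End ℝ (Form n 3) where
  toFun F := (1 / 6 : ℝ) • MultilinearMap.alternatization (contraction Ω F)
  map_add' F G := by
    have : contraction Ω (F + G) = contraction Ω F + contraction Ω G := by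
      ext v
      simp [contraction, mul_add, Finset.sum_add_distrib]
    rw [this, map_add, smul_add]
  map_smul' c F := by
    have : contraction Ω (c • F) = c • contraction Ω F := by
      ext v
      simp [contraction, mul_left_comm, Finset.mul_sum]
    ext v
    simp only [this, MultilinearMap.alternatization_apply, AlternatingMap.smul_apply,
      smul_apply, MultilinearMap.domDomCongr_apply, smul_comm _ c,
      ← Finset.smul_sum, RingHom.id_apply]

/-- The duality operator `b_Ω` is of order `N` if it has exactly `N` distinct eigenvalues. (For a
four-form, `b_Ω` is symmetric, so that all its eigenvalues are real.) -/
def IsOfOrder {n : ℕ} (Ω : Form n 4) (N : ℕ) : Prop :=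
  {β : ℝ | (dualityOperator Ω).HasEigenvalue β}.ncard = N

/-- `Λᵏ ℝⁿ` is the direct sum of `r` irreducible submodules for the Lie algebra `𝔥`. -/
def HasIrreducibleDecomposition {n : ℕ} (𝔥 : LieSubalgebra ℝ (Matrix (Fin n) (Fin n) ℝ))
    (k r : ℕ) : Prop :=
  ∃ W : Fin r → LieSubmodule ℝ 𝔥 (Form n k),
    (∀ α, LieModule.IsIrreducible ℝ 𝔥 (W α)) ∧
      DirectSum.IsInternal fun α => (W α).toSubmodule

/-- For a four-form `Ω` that is invariant under a Lie subalgebra `𝔥 ⊆ 𝔰𝔬(n)`, the duality operator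
`b_Ω : Λ³ ℝⁿ → Λ³ ℝⁿ` is perfect if it is of order `r`, where `r` is the number of irreducible
summands of the `𝔥`-module `Λ³ ℝⁿ`. -/
structure IsPerfect {n : ℕ} (𝔥 : LieSubalgebra ℝ (Matrix (Fin n) (Fin n) ℝ)) (Ω : Form n 4) :
    Prop where
  le_so : 𝔥 ≤ LieAlgebra.Orthogonal.so (Fin n) ℝ
  invariant : ∀ A ∈ 𝔥, ⁅A, Ω⁆ = 0
  order : ∃ r : ℕ, IsOfOrder Ω r ∧ HasIrreducibleDecomposition 𝔥 3 r

/-! ### The four-form `Θ` and `𝔰𝔭𝔦𝔫(7)` -/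

/-- The decomposable form `e^{i₁} ∧ ⋯ ∧ e^{iₖ}`, i.e. `(v₁, …, vₖ) ↦ det ((v_a)_{i_b})`. -/
def wedge {n k : ℕ} (i : Fin k → Fin n) : Form n k :=
  Matrix.detRowAlternating.compLinearMap (LinearMap.funLeft ℝ ℝ i)

theorem wedge_apply {n k : ℕ} (i : Fin k → Fin n) (v : Fin k → Fin n → ℝ) :
    wedge i v = (Matrix.of fun a b => v a (i b)).det := rfl

/-- The four-form `Θ` on `ℝ⁸` with `Θ_{ijkl} = 1` for
`(ijkl) = (1245), (1276), (1346), (1357), (2356), (2437), (4567),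
(1238), (4358), (4718), (5168), (5728), (6248), (6738)`
and all components vanishing that do not follow from these by antisymmetry. In the code the
coordinates of `ℝ⁸` are numbered from `0` to `7`. -/
def Θ : Form 8 4 :=
  wedge ![0, 1, 3, 4] + wedge ![0, 1, 6, 5] + wedge ![0, 2, 3, 5]
    + wedge ![0, 2, 4, 6] + wedge ![1, 2, 4, 5] + wedge ![1, 3, 2, 6]
    + wedge ![3, 4, 5, 6] + wedge ![0, 1, 2, 7] + wedge ![3, 2, 4, 7]
    + wedge ![3, 6, 0, 7] + wedge ![4, 0, 5, 7] + wedge ![4, 6, 1, 7]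
    + wedge ![5, 1, 3, 7] + wedge ![5, 6, 2, 7]

/-- The Lie algebra `𝔰𝔭𝔦𝔫(7) ⊆ 𝔰𝔬(8)`: the stabilizer of the four-form `Θ`. -/
def spin7 : LieSubalgebra ℝ (Matrix (Fin 8) (Fin 8) ℝ) := stabilizer Θ

end SpinSevenDuality

/-! Let ι(v) = Θ(v, ⬝, ⬝, ⬝) (`interior`), and let ι* (`contractTheta`) be its adjoint for the inner
product on three-forms in which the e^i ∧ e^j ∧ e^k with i < j < k are orthonormal. Two identities
carry the spectral part: ι*ι = 7 (`eval_thetaForm`) and b_Θ = (2/3)(1 - ιι*) (`dualityOperator_eq`).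
Hence b_Θ is (2/3)(1 - 7) = -4 on the image of ι and 2/3 on the kernel of ι*. This gives the
quadratic relation, the splitting and the dimensions 8 and 56 - 8. Invariance of Θ makes ι
equivariant, and skew-symmetry then makes ι* equivariant, so the eigenspaces are submodules.

For irreducibility, the supports of the 14 terms of Θ are blocks such that each triple of indices
lies in exactly one of them and each pair in three. Every block {a,b,c,d} gives an element g =
E_{ab} + Θ_{abcd} E_{cd} of the stabilizer. On ℝ⁸, -g² is the coordinate projection to four axes.
Three such projections compose to the projection to a single axis, and the generators carry each
axis to every other; so the image of ι is irreducible.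

On three-forms g has eigenvalues 0, ±i, ±2i, so g⁴ + g² is 12 times the projection to the ±2i part,
which meets the image of ι ≅ ℝ⁸ trivially. For two generators sharing E_{ab} these projections
compose to the projection to a plane, which one of them rotates (`quartic_quartic`, `lie_planeFst`).
A submodule therefore contains every such plane to which one of its elements is not orthogonal. The
planes form a tight frame of the kernel of ι* (`frame_formula`), and non-orthogonality links all of
them (`planes_connected`). So a nonzero submodule of the kernel contains one plane, then all planes,
then the whole kernel.

There is no third irreducible submodule because the two dimensions differ (`isAtom_iff_of_isCompl`).
The component identities are finite: both sides are integral linear combinations of components of an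
arbitrary form, and their difference is normalized to the empty list by kernel evaluation. -/

namespace SpinSevenDuality

/-! ### Components of forms -/

/-- A form is determined by its components with increasing indices. -/
theorem form_ext_strictMono {n k : ℕ} {F G : Form n k}
    (h : ∀ v : Fin k → Fin n, StrictMono v → F (fun a => e (v a)) = G (fun a => e (v a))) :
    F = G := by
  refine Module.Basis.ext_alternating (Pi.basisFun ℝ (Fin n)) fun v hv => ?_
  simp only [Pi.basisFun_apply]
  have hs : StrictMono (v ∘ Tuple.sort v) :=
    (Tuple.monotone_sort v).strictMono_of_injective (hv.comp (Equiv.injective _))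
  have h1 := h _ hs
  have key (K : Form n k) : K (fun a => e ((v ∘ Tuple.sort v) a))
      = Equiv.Perm.sign (Tuple.sort v) • K (fun a => e (v a)) :=
    K.map_perm (fun a => e (v a)) (Tuple.sort v)
  rw [key, key] at h1
  exact smul_left_cancel _ h1

/-- The component `F_{ijk}` of a three-form. -/
def comp (F : Form 8 3) (i j k : Fin 8) : ℝ := F ![e i, e j, e k]

theorem threeForm_ext {F G : Form 8 3}
    (h : ∀ i j, i < j → ∀ k, j < k → comp F i j k = comp G i j k) : F = G := by
  refine form_ext_strictMono fun v hv => ?_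
  have hv' : (fun a => e (v a) : Fin 3 → Fin 8 → ℝ) = ![e (v 0), e (v 1), e (v 2)] := by
    ext a : 1; fin_cases a <;> rfl
  rw [hv']
  exact h _ _ (hv (by decide)) _ (hv (by decide))

theorem fourForm_ext {F G : Form 8 4}
    (h : ∀ i j, i < j → ∀ k, j < k → ∀ l, k < l →
      F ![e i, e j, e k, e l] = G ![e i, e j, e k, e l]) : F = G := by
  refine form_ext_strictMono fun v hv => ?_
  have hv' : (fun a => e (v a) : Fin 4 → Fin 8 → ℝ)
      = ![e (v 0), e (v 1), e (v 2), e (v 3)] := by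
    ext a : 1; fin_cases a <;> rfl
  rw [hv']
  exact h _ _ (hv (by decide)) _ (hv (by decide)) _ (hv (by decide))

theorem form_swap_zero_one (F : Form 8 3) (x y z : Fin 8 → ℝ) : F ![y, x, z] = -F ![x, y, z] := by
  rw [← F.map_swap ![x, y, z] (i := 0) (j := 1) (by decide)]
  congr 1; ext a : 1; fin_cases a <;> rfl

theorem form_swap_one_two (F : Form 8 3) (x y z : Fin 8 → ℝ) : F ![x, z, y] = -F ![x, y, z] := by
  rw [← F.map_swap ![x, y, z] (i := 1) (j := 2) (by decide)]
  congr 1; ext a : 1; fin_cases a <;> rfl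

theorem comp_swap_left (F : Form 8 3) (i j k : Fin 8) : comp F j i k = -comp F i j k :=
  form_swap_zero_one F _ _ _

theorem comp_swap_right (F : Form 8 3) (i j k : Fin 8) : comp F i k j = -comp F i j k :=
  form_swap_one_two F _ _ _

theorem comp_self_left (F : Form 8 3) (i k : Fin 8) : comp F i i k = 0 := by
  linarith [comp_swap_left F i i k]

theorem comp_self_right (F : Form 8 3) (i k : Fin 8) : comp F i k k = 0 := by
  linarith [comp_swap_right F i k k]

@[simp] theorem comp_add (F G : Form 8 3) (i j k : Fin 8) :
    comp (F + G) i j k = comp F i j k + comp G i j k := rfl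

@[simp] theorem comp_sub (F G : Form 8 3) (i j k : Fin 8) :
    comp (F - G) i j k = comp F i j k - comp G i j k := rfl

@[simp] theorem comp_smul (c : ℝ) (F : Form 8 3) (i j k : Fin 8) :
    comp (c • F) i j k = c * comp F i j k := rfl

@[simp] theorem comp_zero (i j k : Fin 8) : comp 0 i j k = 0 := rfl

@[simp] theorem comp_sum {ι : Type*} (s : Finset ι) (F : ι → Form 8 3) (i j k : Fin 8) :
    comp (∑ a ∈ s, F a) i j k = ∑ a ∈ s, comp (F a) i j k :=
  map_sum (AddMonoidHom.mk' (fun G : Form 8 3 => comp G i j k) fun _ _ => rfl) F s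

/-! ### Integral linear combinations of components -/

/-- The linear combination `∑ c F_{ijk}` of components of `F`, as a list of its terms
`(c, i, j, k)`. -/
abbrev Combination : Type := List (ℤ × Fin 8 × Fin 8 × Fin 8)

/-- The value of a linear combination of components. -/
def eval (F : Form 8 3) : Combination → ℝ
  | [] => 0
  | (c, i, j, k) :: L => c * comp F i j k + eval F L

@[simp] theorem eval_nil (F : Form 8 3) : eval F [] = 0 := rfl

@[simp] theorem eval_cons (F : Form 8 3) (c : ℤ) (i j k : Fin 8) (L : Combination) :
    eval F ((c, i, j, k) :: L) = c * comp F i j k + eval F L := rfl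

theorem eval_add_form (F G : Form 8 3) (L : Combination) :
    eval (F + G) L = eval F L + eval G L := by
  induction L with
  | nil => simp
  | cons t L ih => obtain ⟨c, i, j, k⟩ := t; simp [ih]; ring

theorem eval_smul_form (a : ℝ) (F : Form 8 3) (L : Combination) :
    eval (a • F) L = a * eval F L := by
  induction L with
  | nil => simp
  | cons t L ih => obtain ⟨c, i, j, k⟩ := t; simp [ih]; ring

/-- A linear combination of components as a linear functional. -/
def evalₗ (L : Combination) : Form 8 3 →ₗ[ℝ] ℝ where
  toFun F := eval F L
  map_add' F G := eval_add_form F G L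
  map_smul' a F := eval_smul_form a F L

/-- `List.foldr`, in a form that evaluates fast. -/
def fold {α β : Type} (f : α → β → β) (b : β) (l : List α) : β :=
  List.rec (motive := fun _ => β) b (fun a _ ih => f a ih) l

@[simp] theorem fold_nil {α β : Type} (f : α → β → β) (b : β) : fold f b [] = b := rfl

@[simp] theorem fold_cons {α β : Type} (f : α → β → β) (b : β) (a : α) (l : List α) :
    fold f b (a :: l) = f a (fold f b l) := rfl

/-- Equality of indices, in a form that evaluates fast. -/
def eqb (i j : Fin 8) : Bool := Nat.beq i.val j.val

theorem eqb_iff {i j : Fin 8} : eqb i j = true ↔ i = j := by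
  rw [eqb, Nat.beq_eq, Fin.val_inj]

theorem cond_eqb {α : Sort*} (i j : Fin 8) (x y : α) :
    cond (eqb i j) x y = if i = j then x else y := by
  rw [Bool.cond_eq_ite]; simp only [eqb_iff]

/-- The order of indices, in a form that evaluates fast. -/
def ltb (i j : Fin 8) : Bool := Nat.ble (i.val + 1) j.val

theorem cond_ltb {α : Sort*} (i j : Fin 8) (x y : α) :
    cond (ltb i j) x y = if i < j then x else y := by
  have : ltb i j = true ↔ i < j := by rw [ltb, Nat.ble_eq, Nat.succ_le_iff, Fin.lt_def]
  rw [Bool.cond_eq_ite]; simp only [this]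

/-- The vanishing of an integer, in a form that evaluates fast. -/
def isZero (c : ℤ) : Bool := Nat.beq c.natAbs 0

theorem isZero_iff {c : ℤ} : isZero c = true ↔ c = 0 := by
  rw [isZero, Nat.beq_eq, Int.natAbs_eq_zero]

theorem cond_isZero {α : Sort*} (c : ℤ) (x y : α) :
    cond (isZero c) x y = if c = 0 then x else y := by
  rw [Bool.cond_eq_ite]; simp only [isZero_iff]

/-- Add the term `c F_{ijk}`, collecting terms with the same indices. -/
def addTerm (c : ℤ) (i j k : Fin 8) (L : Combination) : Combination :=
  List.rec (motive := fun _ => Combination) (cond (isZero c) [] [(c, i, j, k)])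
    (fun t L ih => cond (eqb i t.2.1) (cond (eqb j t.2.2.1) (cond (eqb k t.2.2.2)
      (cond (isZero (t.1 + c)) L ((t.1 + c, t.2) :: L)) (t :: ih)) (t :: ih)) (t :: ih)) L

theorem addTerm_cons (c d : ℤ) (i j k i' j' k' : Fin 8) (L : Combination) :
    addTerm c i j k ((d, i', j', k') :: L) =
      cond (eqb i i') (cond (eqb j j') (cond (eqb k k')
        (cond (isZero (d + c)) L ((d + c, i', j', k') :: L))
        ((d, i', j', k') :: addTerm c i j k L)) ((d, i', j', k') :: addTerm c i j k L))
        ((d, i', j', k') :: addTerm c i j k L) := rfl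

theorem eval_addTerm (F : Form 8 3) (c : ℤ) (i j k : Fin 8) (L : Combination) :
    eval F (addTerm c i j k L) = c * comp F i j k + eval F L := by
  induction L with
  | nil =>
    change eval F (cond (isZero c) [] [(c, i, j, k)]) = _
    rw [cond_isZero]
    split_ifs with h <;> simp [h]
  | cons t L ih =>
    obtain ⟨d, i', j', k'⟩ := t
    simp only [addTerm_cons, cond_eqb, cond_isZero]
    have ih' : eval F ((d, i', j', k') :: addTerm c i j k L)
        = c * comp F i j k + eval F ((d, i', j', k') :: L) := by
      simp only [eval_cons, ih]; ring
    split_ifs with hi hj hk h'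
    · have : (d : ℝ) + c = 0 := by exact_mod_cast h'
      rw [eval_cons, hi, hj, hk, ← add_assoc, ← add_mul, add_comm (c : ℝ), this]; simp
    · simp only [eval_cons, hi, hj, hk]; push_cast; ring
    all_goals exact ih'

/-- Add the term `c F_{ijk}` after sorting its indices. -/
def addSorted (c : ℤ) (i j k : Fin 8) (L : Combination) : Combination :=
  cond (ltb i j)
    (cond (ltb j k) (addTerm c i j k L) (cond (eqb j k) L
      (cond (ltb i k) (addTerm (-c) i k j L) (cond (eqb i k) L (addTerm c k i j L)))))
    (cond (eqb i j) L
      (cond (ltb i k) (addTerm (-c) j i k L) (cond (eqb i k) L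
        (cond (ltb j k) (addTerm c j k i L) (cond (eqb j k) L (addTerm (-c) k j i L))))))

theorem eval_addSorted (F : Form 8 3) (c : ℤ) (i j k : Fin 8) (L : Combination) :
    eval F (addSorted c i j k L) = c * comp F i j k + eval F L := by
  have h1 := comp_swap_left F i j k
  have h2 := comp_swap_right F i j k
  have h3 := comp_swap_left F i k j
  have h4 := comp_swap_right F j i k
  have h5 := comp_swap_left F j k i
  unfold addSorted
  simp only [cond_eqb, cond_ltb]
  split_ifs
  all_goals (try rw [eval_addTerm]) <;>
    simp_all [comp_self_left, comp_self_right]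

/-- Add `a • L` to a linear combination, sorting indices and collecting terms. -/
def addScaled (a : ℤ) (L M : Combination) : Combination :=
  cond (isZero a) M (fold (fun t N => addSorted (a * t.1) t.2.1 t.2.2.1 t.2.2.2 N) M L)

@[simp] theorem eval_addScaled (F : Form 8 3) (a : ℤ) (L M : Combination) :
    eval F (addScaled a L M) = a * eval F L + eval F M := by
  rw [addScaled, cond_isZero]
  split_ifs with h
  · simp [h]
  · induction L with
    | nil => simp
    | cons t L ih =>
      obtain ⟨c, i, j, k⟩ := t
      simp only [fold_cons, eval_addSorted, ih, eval_cons]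
      push_cast; ring

theorem eval_fold_addScaled {α : Type} (F : Form 8 3) (a : α → ℤ) (f : α → Combination)
    (M : Combination) (l : List α) :
    eval F (fold (fun x N => addScaled (a x) (f x) N) M l)
      = (l.map fun x => a x * eval F (f x)).sum + eval F M := by
  induction l with
  | nil => simp
  | cons x l ih => simp [ih, add_assoc]

theorem eval_eq_zero (F : Form 8 3) {L : Combination} (h : L.isEmpty = true) : eval F L = 0 := by
  rw [List.isEmpty_iff.1 h, eval_nil]

/-! ### Components of decomposable forms -/

/-- The determinant of `δ_{a i}`, `δ_{a j}`, `δ_{b i}`, `δ_{b j}`. -/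
def delta₂ (a b i j : Fin 8) : ℤ :=
  cond (eqb i a) (cond (eqb j b) 1 0) 0 - cond (eqb i b) (cond (eqb j a) 1 0) 0

/-- The component of `e^a ∧ e^b ∧ e^c` with the indices `i, j, k`. -/
def delta₃ (a b c i j k : Fin 8) : ℤ :=
  cond (eqb i a) (delta₂ b c j k) 0 - cond (eqb i b) (delta₂ a c j k) 0
    + cond (eqb i c) (delta₂ a b j k) 0

/-- The component of `e^a ∧ e^b ∧ e^c ∧ e^d` with the indices `i, j, k, l`. -/
def delta₄ (a b c d i j k l : Fin 8) : ℤ :=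
  cond (eqb i a) (delta₃ b c d j k l) 0 - cond (eqb i b) (delta₃ a c d j k l) 0
    + cond (eqb i c) (delta₃ a b d j k l) 0 - cond (eqb i d) (delta₃ a b c j k l) 0

theorem e_apply (i a : Fin 8) : (e i : Fin 8 → ℝ) a = if i = a then 1 else 0 := by
  simp [Pi.single_apply, eq_comm]

theorem delta₂_eq (a b i j : Fin 8) : (delta₂ a b i j : ℝ)
    = (e i : Fin 8 → ℝ) a * (e j : Fin 8 → ℝ) b - (e i : Fin 8 → ℝ) b * (e j : Fin 8 → ℝ) a := by
  unfold delta₂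
  simp only [e_apply, cond_eqb]
  split_ifs <;> simp

theorem delta₃_eq (a b c i j k : Fin 8) : (delta₃ a b c i j k : ℝ)
    = (e i : Fin 8 → ℝ) a * delta₂ b c j k - (e i : Fin 8 → ℝ) b * delta₂ a c j k
      + (e i : Fin 8 → ℝ) c * delta₂ a b j k := by
  unfold delta₃
  simp only [e_apply, cond_eqb]
  split_ifs <;> simp

theorem delta₄_eq (a b c d i j k l : Fin 8) : (delta₄ a b c d i j k l : ℝ)
    = (e i : Fin 8 → ℝ) a * delta₃ b c d j k l - (e i : Fin 8 → ℝ) b * delta₃ a c d j k l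
      + (e i : Fin 8 → ℝ) c * delta₃ a b d j k l - (e i : Fin 8 → ℝ) d * delta₃ a b c j k l := by
  unfold delta₄
  simp only [e_apply, cond_eqb]
  split_ifs <;> simp

theorem comp_wedge (a b c i j k : Fin 8) : comp (wedge ![a, b, c]) i j k = delta₃ a b c i j k := by
  unfold comp
  rw [wedge_apply, Matrix.det_fin_three, delta₃_eq, delta₂_eq, delta₂_eq, delta₂_eq]
  simp only [Matrix.of_apply, Matrix.cons_val]
  ring

theorem wedge_four_apply (a b c d i j k l : Fin 8) :
    wedge ![a, b, c, d] ![e i, e j, e k, e l] = delta₄ a b c d i j k l := by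
  rw [wedge_apply, Matrix.det_succ_row_zero]
  simp only [Fin.sum_univ_four, Matrix.det_fin_three]
  have s0 : Fin.succAbove (0 : Fin 4) = ![1, 2, 3] := by decide
  have s1 : Fin.succAbove (1 : Fin 4) = ![0, 2, 3] := by decide
  have s2 : Fin.succAbove (2 : Fin 4) = ![0, 1, 3] := by decide
  have s3 : Fin.succAbove (3 : Fin 4) = ![0, 1, 2] := by decide
  simp only [Matrix.of_apply, Matrix.submatrix_apply, s0, s1, s2, s3, delta₄_eq, delta₃_eq,
    delta₂_eq]
  have t0 : Fin.succ (0 : Fin 3) = 1 := rfl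
  have t1 : Fin.succ (1 : Fin 3) = 2 := rfl
  have t2 : Fin.succ (2 : Fin 3) = 3 := rfl
  simp only [Matrix.cons_val, t0, t1, t2, Fin.coe_ofNat_eq_mod]
  norm_num only
  ring

/-- The form with the components given by the coefficients of a linear combination. -/
def toForm : Combination → Form 8 3
  | [] => 0
  | (c, i, j, k) :: L => (c : ℝ) • wedge ![i, j, k] + toForm L

/-- Membership in a triple of indices. -/
def memTriple (i a b c : Fin 8) : Bool := cond (eqb i a) true (cond (eqb i b) true (eqb i c))

theorem memTriple_iff {i a b c : Fin 8} : memTriple i a b c = true ↔ i = a ∨ i = b ∨ i = c := by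
  rw [memTriple, cond_eqb, cond_eqb]
  split_ifs with h1 h2 <;> simp [*, eqb_iff]

/-- The coefficients of a linear combination, extended antisymmetrically. -/
def coeff (i j k : Fin 8) (L : Combination) : ℤ :=
  fold (fun t n => cond (memTriple k t.2.1 t.2.2.1 t.2.2.2)
    (cond (memTriple j t.2.1 t.2.2.1 t.2.2.2) (cond (memTriple i t.2.1 t.2.2.1 t.2.2.2)
      (t.1 * delta₃ t.2.1 t.2.2.1 t.2.2.2 i j k + n) n) n) n) 0 L

@[simp] theorem coeff_nil (i j k : Fin 8) : coeff i j k [] = 0 := rfl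

theorem delta₃_comm (a b c i j k : Fin 8) : delta₃ a b c i j k = delta₃ i j k a b c := by
  have h (p q : Fin 8) : (e p : Fin 8 → ℝ) q = (e q : Fin 8 → ℝ) p := by simp [e_apply, eq_comm]
  have : (delta₃ a b c i j k : ℝ) = delta₃ i j k a b c := by
    simp only [delta₃_eq, delta₂_eq, h _ a, h _ b, h _ c]
    ring
  exact_mod_cast this

theorem delta₃_swap (a b c i j k : Fin 8) : delta₃ a b c i j k = -delta₃ a b c j i k := by
  have : (delta₃ a b c i j k : ℝ) = -delta₃ a b c j i k := by
    simp only [delta₃_eq, delta₂_eq]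
    ring
  exact_mod_cast this

theorem delta₃_rotate (a b c i j k : Fin 8) : delta₃ a b c i j k = delta₃ a b c k i j := by
  have : (delta₃ a b c i j k : ℝ) = delta₃ a b c k i j := by
    simp only [delta₃_eq, delta₂_eq]
    ring
  exact_mod_cast this

theorem coeff_cons (i j k : Fin 8) (c : ℤ) (a b d : Fin 8) (L : Combination) :
    coeff i j k ((c, a, b, d) :: L) = c * delta₃ a b d i j k + coeff i j k L := by
  have h (i j k : Fin 8) (hi : ¬memTriple i a b d = true) : delta₃ a b d i j k = 0 := by
    rw [memTriple_iff, not_or, not_or] at hi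
    simp [delta₃, cond_eqb, hi]
  have hx : coeff i j k ((c, a, b, d) :: L) = cond (memTriple k a b d) (cond (memTriple j a b d)
      (cond (memTriple i a b d) (c * delta₃ a b d i j k + coeff i j k L) (coeff i j k L))
      (coeff i j k L)) (coeff i j k L) := rfl
  rw [hx]
  simp only [Bool.cond_eq_ite]
  split_ifs with hk hj hi
  · rfl
  · rw [h i j k hi, mul_zero, zero_add]
  -- `h` concerns the first index; a transposition, and below a rotation, brings the failing index
  -- there.
  · rw [delta₃_swap, h j i k hj, neg_zero, mul_zero, zero_add]
  · rw [delta₃_rotate, h k i j hk, mul_zero, zero_add]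

theorem comp_toForm (L : Combination) (i j k : Fin 8) :
    comp (toForm L) i j k = coeff i j k L := by
  induction L with
  | nil => simp [toForm]
  | cons t L ih =>
    obtain ⟨c, a, b, d⟩ := t
    simp [toForm, coeff_cons, ih, comp_wedge]

/-- The natural pairing of linear combinations. -/
def pairing (L M : Combination) : ℤ :=
  fold (fun t n => t.1 * coeff t.2.1 t.2.2.1 t.2.2.2 M + n) 0 L

theorem eval_toForm (L M : Combination) : eval (toForm M) L = pairing L M := by
  induction L with
  | nil => simp [pairing]
  | cons t L ih =>
    obtain ⟨c, i, j, k⟩ := t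
    rw [pairing] at ih ⊢
    simp [ih, comp_toForm]

/-- The pairing of basis forms is symmetric. This turns an identity between functionals `eval F L`,
valid for all `F`, into an identity between the forms `toForm L`. -/
theorem comp_toForm_eq_eval_wedge (L : Combination) (i j k : Fin 8) :
    comp (toForm L) i j k = eval (wedge ![i, j, k]) L := by
  induction L with
  | nil => simp [toForm]
  | cons t L ih =>
    obtain ⟨c, a, b, d⟩ := t
    simp [toForm, ih, comp_wedge, delta₃_comm a b d]

/-- The inner product of three-forms, up to the factor `6`. -/
def innerProd (F G : Form 8 3) : ℝ := ∑ i, ∑ j, ∑ k, comp F i j k * comp G i j k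

/-- The unrestricted sum meets each set of three indices 3! times, with equal products of signs. -/
theorem innerProd_toForm (L : Combination) (F : Form 8 3) :
    innerProd (toForm L) F = 6 * eval F L := by
  induction L with
  | nil => simp [innerProd, toForm]
  | cons t L ih =>
    obtain ⟨c, a, b, d⟩ := t
    have h1 := comp_swap_left F a b d
    have h2 := comp_swap_right F a b d
    have h3 := comp_swap_left F a d b
    have h4 := comp_swap_right F b a d
    have h5 := comp_swap_left F b d a
    have key : ∑ i, ∑ j, ∑ k, (delta₃ a b d i j k : ℝ) * comp F i j k = 6 * comp F a b d := by
      simp only [delta₃_eq, delta₂_eq, e_apply, sub_mul, mul_sub, add_mul, Finset.sum_add_distrib,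
        Finset.sum_sub_distrib, ite_mul, one_mul, zero_mul, Finset.sum_ite_eq',
        Finset.mem_univ, if_true, Finset.sum_ite_irrel, Finset.sum_const_zero]
      linarith
    rw [eval_cons, mul_add, ← ih, ← mul_assoc, mul_comm (6 : ℝ) c, mul_assoc, ← key]
    simp only [innerProd, toForm, comp_add, comp_smul, comp_wedge, add_mul,
      Finset.sum_add_distrib, Finset.mul_sum, mul_assoc]

/-! ### The action of matrices in components -/

theorem lie_apply {n k : ℕ} (A : Matrix (Fin n) (Fin n) ℝ) (F : Form n k)
    (v : Fin k → Fin n → ℝ) :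
    ⁅A, F⁆ v = - ∑ i, F (Function.update v i (A.mulVec (v i))) := rfl

theorem lie_three_apply (A : Matrix (Fin 8) (Fin 8) ℝ) (F : Form 8 3) (x y z : Fin 8 → ℝ) :
    ⁅A, F⁆ ![x, y, z]
      = -(F ![A.mulVec x, y, z] + F ![x, A.mulVec y, z] + F ![x, y, A.mulVec z]) := by
  rw [lie_apply, Fin.sum_univ_three]
  congr 4 <;> · ext a : 1; fin_cases a <;> rfl

theorem lie_four_apply (A : Matrix (Fin 8) (Fin 8) ℝ) (F : Form 8 4) (w x y z : Fin 8 → ℝ) :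
    ⁅A, F⁆ ![w, x, y, z]
      = -(F ![A.mulVec w, x, y, z] + F ![w, A.mulVec x, y, z] + F ![w, x, A.mulVec y, z]
        + F ![w, x, y, A.mulVec z]) := by
  rw [lie_apply, Fin.sum_univ_four]
  congr 5 <;> · ext a : 1; fin_cases a <;> rfl

theorem mulVec_e {n : ℕ} (A : Matrix (Fin n) (Fin n) ℝ) (i : Fin n) :
    A.mulVec (e i) = ∑ p, A p i • e p := by
  ext q
  simp [Finset.sum_apply, Pi.single_apply]

theorem form_three_sum (F : Form 8 3) {ι : Type*} (s : Finset ι) (c : ι → ℝ)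
    (x : ι → Fin 8 → ℝ) (y z : Fin 8 → ℝ) :
    F ![∑ p ∈ s, c p • x p, y, z] = ∑ p ∈ s, c p * F ![x p, y, z] := by
  have h (u : Fin 8 → ℝ) : F ![u, y, z] = F.toMultilinearMap.toLinearMap ![0, y, z] 0 u := by
    rw [MultilinearMap.toLinearMap_apply]
    change _ = F _
    congr 1
    ext a : 1; fin_cases a <;> rfl
  simp only [h, map_sum, map_smul, smul_eq_mul]

theorem form_four_sum (F : Form 8 4) {ι : Type*} (s : Finset ι) (c : ι → ℝ)
    (x : ι → Fin 8 → ℝ) (w y z : Fin 8 → ℝ) :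
    F ![∑ p ∈ s, c p • x p, w, y, z] = ∑ p ∈ s, c p * F ![x p, w, y, z] := by
  have h (u : Fin 8 → ℝ) :
      F ![u, w, y, z] = F.toMultilinearMap.toLinearMap ![0, w, y, z] 0 u := by
    rw [MultilinearMap.toLinearMap_apply]
    change _ = F _
    congr 1
    ext a : 1; fin_cases a <;> rfl
  simp only [h, map_sum, map_smul, smul_eq_mul]

theorem comp_lie (A : Matrix (Fin 8) (Fin 8) ℝ) (F : Form 8 3) (i j k : Fin 8) :
    comp ⁅A, F⁆ i j k
      = -∑ p, (A p i * comp F p j k + A p j * comp F i p k + A p k * comp F i j p) := by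
  have h2 (x y z : Fin 8 → ℝ) : F ![x, y, z] = -F ![y, x, z] := form_swap_zero_one F y x z
  have h3 (x y z : Fin 8 → ℝ) : F ![x, y, z] = F ![z, x, y] := by
    rw [form_swap_one_two F x z y, form_swap_zero_one F z x y, neg_neg]
  have c2 (p) : comp F i p k = -comp F p i k := h2 _ _ _
  have c3 (p) : comp F i j p = comp F p i j := h3 _ _ _
  simp only [c2, c3]
  unfold comp
  rw [lie_three_apply, h2 (e i) _ _, h3 (e i) (e j) _]
  simp only [mulVec_e, form_three_sum, Finset.sum_add_distrib, mul_neg, Finset.sum_neg_distrib]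

/-! ### The four-form in components -/

/-- The indices of the coordinates of `ℝ⁸`. -/
def indices : List (Fin 8) := [0, 1, 2, 3, 4, 5, 6, 7]

theorem mem_indices (i : Fin 8) : i ∈ indices := by
  fin_cases i <;> simp [indices]

theorem sum_eq_sum_indices (f : Fin 8 → ℝ) : ∑ i, f i = (indices.map f).sum := by
  simp [Fin.sum_univ_eight, indices, add_assoc]

/-- The indices of the terms of `Θ`. -/
def blocks : List (Fin 8 × Fin 8 × Fin 8 × Fin 8) :=
  [(0, 1, 3, 4), (0, 1, 6, 5), (0, 2, 3, 5), (0, 2, 4, 6), (1, 2, 4, 5), (1, 3, 2, 6),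
    (3, 4, 5, 6), (0, 1, 2, 7), (3, 2, 4, 7), (3, 6, 0, 7), (4, 0, 5, 7), (4, 6, 1, 7),
    (5, 1, 3, 7), (5, 6, 2, 7)]

/-- Add the terms of `e_p ⌟ (e^a ∧ e^b ∧ e^c ∧ e^d)`. -/
def addInterior (p : Fin 8) (t : Fin 8 × Fin 8 × Fin 8 × Fin 8) (L : Combination) : Combination :=
  cond (eqb p t.1) ((1, t.2.1, t.2.2.1, t.2.2.2) :: L)
    (cond (eqb p t.2.1) ((-1, t.1, t.2.2.1, t.2.2.2) :: L)
    (cond (eqb p t.2.2.1) ((1, t.1, t.2.1, t.2.2.2) :: L)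
    (cond (eqb p t.2.2.2) ((-1, t.1, t.2.1, t.2.2.1) :: L) L)))

/-- The terms of `Θ(e_p, ⬝, ⬝, ⬝)`. -/
def thetaRow (p : Fin 8) : Combination := fold (addInterior p) [] blocks

/-- The three-form `Θ(e_p, ⬝, ⬝, ⬝)`. -/
def thetaForm (p : Fin 8) : Form 8 3 := Θ.curryLeft (e p)

theorem thetaForm_apply (p : Fin 8) (x y z : Fin 8 → ℝ) :
    thetaForm p ![x, y, z] = Θ ![e p, x, y, z] := rfl

theorem Θ_eq_sum_blocks :
    Θ = (blocks.map fun t => wedge ![t.1, t.2.1, t.2.2.1, t.2.2.2]).sum := by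
  simp [Θ, blocks, add_assoc]

theorem thetaForm_eq (p : Fin 8) : thetaForm p = toForm (thetaRow p) := by
  refine threeForm_ext fun i j _ k _ => ?_
  change Θ ![e p, e i, e j, e k] = _
  -- `addInterior` stops at the first index equal to `p`; since the indices of a block are distinct,
  -- no term of the interior product is lost.
  have hb : ∀ t ∈ blocks, t.1 ≠ t.2.1 ∧ t.1 ≠ t.2.2.1 ∧ t.1 ≠ t.2.2.2 ∧ t.2.1 ≠ t.2.2.1 ∧
      t.2.1 ≠ t.2.2.2 ∧ t.2.2.1 ≠ t.2.2.2 := by simp [blocks]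
  rw [Θ_eq_sum_blocks, thetaRow]
  generalize blocks = l at hb
  induction l with
  | nil => simp [toForm]
  | cons t l ih =>
    have h1 := hb t List.mem_cons_self
    obtain ⟨a, b, c, d⟩ := t
    simp only at h1
    rw [List.map_cons, List.sum_cons, AlternatingMap.add_apply,
      ih fun t ht => hb t (List.mem_cons_of_mem _ ht), fold_cons, wedge_four_apply, delta₄_eq]
    simp only [addInterior, cond_eqb, e_apply]
    split_ifs <;> simp_all [toForm, comp_wedge]

/-- The permutation is even. It brings a free index to the front, so that contractions with Θ can be
read off from `thetaRow`. -/
theorem Θ_swap_pairs (i j k l : Fin 8) :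
    Θ ![e i, e j, e k, e l] = Θ ![e k, e l, e i, e j] := by
  have h := Θ.map_perm ![e i, e j, e k, e l] (Equiv.swap 0 2 * Equiv.swap 1 3)
  have hs : Equiv.Perm.sign (Equiv.swap 0 2 * Equiv.swap 1 3 : Equiv.Perm (Fin 4)) = 1 := by
    decide
  rw [hs, one_smul] at h
  rw [← h]
  congr 1; ext a : 1; fin_cases a <;> rfl

/-- Add the sum `½ ∑ L_{mij} F_{ijn}` for the three-form `L`. -/
def addContract (m n : Fin 8) (L M : Combination) : Combination :=
  fold (fun t M =>
    cond (eqb m t.2.1) (addSorted t.1 t.2.2.1 t.2.2.2 n) id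
    (cond (eqb m t.2.2.1) (addSorted (-t.1) t.2.1 t.2.2.2 n) id
    (cond (eqb m t.2.2.2) (addSorted t.1 t.2.1 t.2.2.1 n) id M))) M L

/-- The factor 2 arises because (i, j) and (j, i) contribute equally, while the list carries one
term for both. -/
theorem eval_addContract (L M : Combination) (F : Form 8 3) (m n : Fin 8) :
    2 * eval F (addContract m n L M)
      = ∑ i, ∑ j, comp (toForm L) m i j * comp F i j n + 2 * eval F M := by
  induction L with
  | nil => simp [addContract, toForm]
  | cons t L ih =>
    obtain ⟨c, a, b, d⟩ := t
    have hc (x : Prop) [Decidable x] (c : ℤ) (i j : Fin 8) (L : Combination) :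
        eval F ((if x then addSorted c i j n else id) L)
          = (if x then c * comp F i j n else 0) + eval F L := by
      split_ifs <;> simp [eval_addSorted]
    have key (a b : Fin 8) :
        ∑ i, ∑ j, (delta₂ a b i j : ℝ) * comp F i j n = 2 * comp F a b n := by
      have h1 := comp_swap_left F a b n
      simp only [delta₂_eq, e_apply, sub_mul, Finset.sum_sub_distrib, ite_mul, one_mul,
        zero_mul, Finset.sum_ite_eq', Finset.mem_univ, if_true, Finset.sum_ite_irrel,
        Finset.sum_const_zero]
      linarith
    have hx : addContract m n ((c, a, b, d) :: L) M
        = cond (eqb m a) (addSorted c b d n) id (cond (eqb m b) (addSorted (-c) a d n) id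
          (cond (eqb m d) (addSorted c a b n) id (addContract m n L M))) := rfl
    rw [hx]
    simp only [cond_eqb, hc, mul_add, ih]
    simp only [toForm, comp_add, comp_smul, comp_wedge, add_mul, Finset.sum_add_distrib,
      delta₃_eq, sub_mul, mul_sub, mul_add, Finset.sum_sub_distrib, mul_assoc,
      ← Finset.mul_sum, key, e_apply]
    split_ifs <;> push_cast <;> ring

/-! ### Generators -/

/-- The data of the matrix `E_{ab} + s E_{cd}`, where `E_{ab}` maps `e_a` to `e_b` and `e_b` to
`-e_a`. -/
structure Generator where
  a : Fin 8
  b : Fin 8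
  c : Fin 8
  d : Fin 8
  s : ℤ

namespace Generator

/-- The index `p` such that the generator maps `e_i` to a multiple of `e_p`. -/
def target (g : Generator) (i : Fin 8) : Fin 8 :=
  cond (eqb i g.a) g.b (cond (eqb i g.b) g.a (cond (eqb i g.c) g.d (cond (eqb i g.d) g.c i)))

/-- The number `c` such that the generator maps `e_i` to `c e_p`. -/
def factor (g : Generator) (i : Fin 8) : ℤ :=
  cond (eqb i g.a) 1 (cond (eqb i g.b) (-1) (cond (eqb i g.c) g.s (cond (eqb i g.d) (-g.s) 0)))

/-- The matrix of a generator. -/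
def toMatrix (g : Generator) : Matrix (Fin 8) (Fin 8) ℝ :=
  Matrix.of fun p i => ((if p = g.target i then g.factor i else 0 : ℤ) : ℝ)

theorem mulVec_e (g : Generator) (i : Fin 8) :
    g.toMatrix.mulVec (e i) = (g.factor i : ℝ) • e (g.target i) := by
  ext q
  simp [toMatrix, Pi.single_apply]

theorem lie_comp (g : Generator) (F : Form 8 3) (i j k : Fin 8) :
    comp ⁅g.toMatrix, F⁆ i j k = -(g.factor i * comp F (g.target i) j k
      + g.factor j * comp F i (g.target j) k + g.factor k * comp F i j (g.target k)) := by
  have h (A : Matrix (Fin 8) (Fin 8) ℝ) (i p : Fin 8) : A p i = (A.mulVec (e i)) p := by simp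
  rw [comp_lie]
  simp only [h g.toMatrix, mulVec_e, Pi.smul_apply, Pi.single_apply, smul_eq_mul, mul_ite,
    mul_one, mul_zero, ite_mul, zero_mul, Finset.sum_add_distrib, Finset.sum_ite_eq',
    Finset.mem_univ, if_true]

/-- The linear combination of components of `F` that is the given linear combination of components
of the image of `F` under the generator. -/
def act (g : Generator) (L : Combination) : Combination :=
  fold (fun t M =>
    cond (isZero (g.factor t.2.1)) id
      (addSorted (-(t.1 * g.factor t.2.1)) (g.target t.2.1) t.2.2.1 t.2.2.2)
    (cond (isZero (g.factor t.2.2.1)) id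
      (addSorted (-(t.1 * g.factor t.2.2.1)) t.2.1 (g.target t.2.2.1) t.2.2.2)
    (cond (isZero (g.factor t.2.2.2)) id
      (addSorted (-(t.1 * g.factor t.2.2.2)) t.2.1 t.2.2.1 (g.target t.2.2.2)) M))) [] L

theorem eval_act (g : Generator) (F : Form 8 3) (L : Combination) :
    eval F (g.act L) = eval ⁅g.toMatrix, F⁆ L := by
  have key (c x : ℤ) (i j k : Fin 8) (M : Combination) :
      eval F (cond (isZero x) id (addSorted (-(c * x)) i j k) M)
        = -(c * x) * comp F i j k + eval F M := by
    rw [cond_isZero]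
    split_ifs with h
    · simp [h]
    · rw [eval_addSorted]; push_cast; ring
  induction L with
  | nil => rfl
  | cons t L ih =>
    obtain ⟨c, i, j, k⟩ := t
    rw [act] at ih ⊢
    rw [fold_cons, key, key, key, ih, eval_cons, lie_comp]
    ring

/-- The condition that the matrix of a generator is skew-symmetric. -/
def IsSkew (g : Generator) : Prop :=
  ∀ p i, (if p = g.target i then g.factor i else 0) = -(if i = g.target p then g.factor p else 0)

instance (g : Generator) : Decidable g.IsSkew := by
  unfold IsSkew; infer_instance

/-- For a skew-symmetric matrix the dual representation -gᵀ equals g, so g acts on covectors as on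
vectors and extends as a derivation. -/
theorem comp_lie_wedge {g : Generator} (hg : g.IsSkew) (i j k l m n : Fin 8) :
    comp ⁅g.toMatrix, wedge ![i, j, k]⁆ l m n
      = g.factor i * comp (wedge ![g.target i, j, k]) l m n
        + g.factor j * comp (wedge ![i, g.target j, k]) l m n
        + g.factor k * comp (wedge ![i, j, g.target k]) l m n := by
  have h (p q : Fin 8) : (g.factor p : ℝ) * (e (g.target p) : Fin 8 → ℝ) q
      = -(g.factor q * (e p : Fin 8 → ℝ) (g.target q)) := by
    have := hg q p
    simp only [e_apply, mul_ite, mul_one, mul_zero]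
    simp only [eq_comm (a := g.target p)]
    exact_mod_cast this
  rw [lie_comp]
  simp only [comp_wedge, delta₃_eq, delta₂_eq]
  set x : Fin 8 → ℝ := e l with hx
  set y : Fin 8 → ℝ := e m with hy
  set z : Fin 8 → ℝ := e n with hz
  have hl := fun q => h l q
  have hm := fun q => h m q
  have hn := fun q => h n q
  simp only [← hx, ← hy, ← hz] at hl hm hn
  -- Up to sign, each coefficient is the 2 × 2 minor complementary to the entry in question.
  linear_combination -(y j * z k - y k * z j) * hl i
    + (y i * z k - y k * z i) * hl j
    - (y i * z j - y j * z i) * hl k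
    + (x j * z k - x k * z j) * hm i
    - (x i * z k - x k * z i) * hm j
    + (x i * z j - x j * z i) * hm k
    - (x j * y k - x k * y j) * hn i
    + (x i * y k - x k * y i) * hn j
    - (x i * y j - x j * y i) * hn k

/-- `act` is the transpose of the action on forms; for skew-symmetric g transposition is a change of
sign. -/
theorem comp_lie_toForm {g : Generator} (hg : g.IsSkew) (L : Combination) :
    ⁅g.toMatrix, toForm L⁆ = -toForm (g.act L) := by
  refine threeForm_ext fun i j _ k _ => ?_
  rw [← neg_one_smul ℝ (toForm _), comp_smul, comp_toForm_eq_eval_wedge, eval_act]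
  have h : ⁅g.toMatrix, wedge ![i, j, k]⁆ = (g.factor i : ℝ) • wedge ![g.target i, j, k]
      + (g.factor j : ℝ) • wedge ![i, g.target j, k]
      + (g.factor k : ℝ) • wedge ![i, j, g.target k] :=
    threeForm_ext fun l m _ n _ => by
      simp only [comp_lie_wedge hg, comp_add, comp_smul]
  rw [h, lie_comp]
  simp only [comp_toForm_eq_eval_wedge, eval_add_form, eval_smul_form]
  ring

/-- By the product rule, (g · Θ)(e_p, ⬝, ⬝, ⬝) = -Θ(g e_p, ⬝, ⬝, ⬝) + g · (Θ(e_p, ⬝, ⬝, ⬝)), so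
invariance reduces to one identity of three-forms for each p. -/
theorem toMatrix_mem_spin7 {g : Generator} (hg : g.IsSkew)
    (h : ∀ p, (addScaled (g.factor p) (thetaRow (g.target p)) (g.act (thetaRow p))).isEmpty
      = true) :
    g.toMatrix ∈ spin7 := by
  constructor
  · rw [LieAlgebra.Orthogonal.mem_so]
    ext i p
    have := hg p i
    simp only [Matrix.transpose_apply, Matrix.neg_apply, toMatrix, Matrix.of_apply]
    exact_mod_cast this
  · refine fourForm_ext fun p i _ j _ k _ => ?_
    have h1 := eval_eq_zero (wedge ![i, j, k]) (h p)
    rw [eval_addScaled, ← comp_toForm_eq_eval_wedge, ← comp_toForm_eq_eval_wedge,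
      ← thetaForm_eq] at h1
    have h2 : comp ⁅g.toMatrix, thetaForm p⁆ i j k = -comp (toForm (g.act (thetaRow p))) i j k := by
      rw [thetaForm_eq, comp_lie_toForm hg, ← neg_one_smul ℝ (toForm _), comp_smul]
      ring
    have h3 : Θ ![(g.factor p : ℝ) • e (g.target p), e i, e j, e k]
        = g.factor p * Θ ![e (g.target p), e i, e j, e k] := by
      have := form_four_sum Θ {p} (fun _ => (g.factor p : ℝ)) (fun _ => e (g.target p)) (e i) (e j)
        (e k)
      simpa only [Finset.sum_singleton] using this
    have h4 : ⁅g.toMatrix, Θ⁆ ![e p, e i, e j, e k]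
        = -Θ ![g.toMatrix.mulVec (e p), e i, e j, e k] + comp ⁅g.toMatrix, thetaForm p⁆ i j k := by
      unfold comp
      rw [lie_four_apply, lie_three_apply]
      simp only [thetaForm_apply]
      ring
    rw [h4, mulVec_e, h3, h2]
    change -((g.factor p : ℝ) * comp (thetaForm (g.target p)) i j k) + _ = 0
    linarith

end Generator

/-- For each pair `a < b`, the three elements `E_{ab} + s E_{cd}` of `𝔰𝔭𝔦𝔫(7)`. -/
def stars : List (Generator × Generator × Generator) := [
  (⟨0, 1, 2, 7, 1⟩, ⟨0, 1, 3, 4, 1⟩, ⟨0, 1, 5, 6, -1⟩),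
  (⟨0, 2, 1, 7, -1⟩, ⟨0, 2, 3, 5, 1⟩, ⟨0, 2, 4, 6, 1⟩),
  (⟨0, 3, 1, 4, -1⟩, ⟨0, 3, 2, 5, -1⟩, ⟨0, 3, 6, 7, 1⟩),
  (⟨0, 4, 1, 3, 1⟩, ⟨0, 4, 2, 6, -1⟩, ⟨0, 4, 5, 7, -1⟩),
  (⟨0, 5, 1, 6, 1⟩, ⟨0, 5, 2, 3, 1⟩, ⟨0, 5, 4, 7, 1⟩),
  (⟨0, 6, 1, 5, -1⟩, ⟨0, 6, 2, 4, 1⟩, ⟨0, 6, 3, 7, -1⟩),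
  (⟨0, 7, 1, 2, 1⟩, ⟨0, 7, 3, 6, 1⟩, ⟨0, 7, 4, 5, -1⟩),
  (⟨1, 2, 0, 7, 1⟩, ⟨1, 2, 3, 6, -1⟩, ⟨1, 2, 4, 5, 1⟩),
  (⟨1, 3, 0, 4, 1⟩, ⟨1, 3, 2, 6, 1⟩, ⟨1, 3, 5, 7, 1⟩),
  (⟨1, 4, 0, 3, -1⟩, ⟨1, 4, 2, 5, -1⟩, ⟨1, 4, 6, 7, 1⟩),
  (⟨1, 5, 0, 6, -1⟩, ⟨1, 5, 2, 4, 1⟩, ⟨1, 5, 3, 7, -1⟩),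
  (⟨1, 6, 0, 5, 1⟩, ⟨1, 6, 2, 3, -1⟩, ⟨1, 6, 4, 7, -1⟩),
  (⟨1, 7, 0, 2, -1⟩, ⟨1, 7, 3, 5, 1⟩, ⟨1, 7, 4, 6, 1⟩),
  (⟨2, 3, 0, 5, 1⟩, ⟨2, 3, 1, 6, -1⟩, ⟨2, 3, 4, 7, -1⟩),
  (⟨2, 4, 0, 6, 1⟩, ⟨2, 4, 1, 5, 1⟩, ⟨2, 4, 3, 7, 1⟩),
  (⟨2, 5, 0, 3, -1⟩, ⟨2, 5, 1, 4, -1⟩, ⟨2, 5, 6, 7, 1⟩),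
  (⟨2, 6, 0, 4, -1⟩, ⟨2, 6, 1, 3, 1⟩, ⟨2, 6, 5, 7, -1⟩),
  (⟨2, 7, 0, 1, 1⟩, ⟨2, 7, 3, 4, -1⟩, ⟨2, 7, 5, 6, 1⟩),
  (⟨3, 4, 0, 1, 1⟩, ⟨3, 4, 2, 7, -1⟩, ⟨3, 4, 5, 6, 1⟩),
  (⟨3, 5, 0, 2, 1⟩, ⟨3, 5, 1, 7, 1⟩, ⟨3, 5, 4, 6, -1⟩),
  (⟨3, 6, 0, 7, 1⟩, ⟨3, 6, 1, 2, -1⟩, ⟨3, 6, 4, 5, 1⟩),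
  (⟨3, 7, 0, 6, -1⟩, ⟨3, 7, 1, 5, -1⟩, ⟨3, 7, 2, 4, 1⟩),
  (⟨4, 5, 0, 7, -1⟩, ⟨4, 5, 1, 2, 1⟩, ⟨4, 5, 3, 6, 1⟩),
  (⟨4, 6, 0, 2, 1⟩, ⟨4, 6, 1, 7, 1⟩, ⟨4, 6, 3, 5, -1⟩),
  (⟨4, 7, 0, 5, 1⟩, ⟨4, 7, 1, 6, -1⟩, ⟨4, 7, 2, 3, -1⟩),
  (⟨5, 6, 0, 1, -1⟩, ⟨5, 6, 2, 7, 1⟩, ⟨5, 6, 3, 4, 1⟩),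
  (⟨5, 7, 0, 4, -1⟩, ⟨5, 7, 1, 3, 1⟩, ⟨5, 7, 2, 6, -1⟩),
  (⟨6, 7, 0, 3, 1⟩, ⟨6, 7, 1, 4, 1⟩, ⟨6, 7, 2, 5, 1⟩)]

/-- Elements of `𝔰𝔭𝔦𝔫(7)` that generate it. -/
def generators : List Generator := stars.flatMap fun t => [t.1, t.2.1, t.2.2]

/-- The pairs of generators `E_{ab} + s E_{cd}` and `E_{ab} + t E_{ef}`. Each pair determines a
plane in `Λ³ ℝ⁸` on which both generators act with eigenvalues `± 2i`. -/
def planes : List (Generator × Generator) :=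
  stars.flatMap fun t => [(t.1, t.2.1), (t.1, t.2.2), (t.2.1, t.2.2)]

/-- The first basis vector of the plane of a pair of generators. -/
def planeFst (p : Generator × Generator) : Combination :=
  [(1, p.1.a, p.1.c, p.2.c), (-p.1.s, p.1.b, p.1.d, p.2.c), (-p.2.s, p.1.b, p.1.c, p.2.d),
    (-(p.1.s * p.2.s), p.1.a, p.1.d, p.2.d)]

/-- The second basis vector of the plane of a pair of generators. -/
def planeSnd (p : Generator × Generator) : Combination :=
  [(1, p.1.b, p.1.c, p.2.c), (p.1.s, p.1.a, p.1.d, p.2.c), (p.2.s, p.1.a, p.1.c, p.2.d),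
    (-(p.1.s * p.2.s), p.1.b, p.1.d, p.2.d)]

namespace Generator

/-- The action of `g⁴ + g²`. -/
def actQuartic (g : Generator) (L : Combination) : Combination :=
  addScaled 1 (g.act (g.act L)) (g.act (g.act (g.act (g.act L))))

/-- The components of the image of `F` under `g⁴ + g²`, which is `12` times the orthogonal
projection to the eigenspace of `g²` for `-4`. -/
def quarticTerm (g : Generator) (i j k : Fin 8) : Combination :=
  cond (isZero (g.factor i))
    (cond (isZero (g.factor j)) [] (cond (isZero (g.factor k)) []
      (cond (eqb (g.target j) k) []
        [(6, i, j, k), (-6 * (g.factor j * g.factor k), i, g.target j, g.target k)])))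
    (cond (isZero (g.factor j))
      (cond (isZero (g.factor k)) []
        (cond (eqb (g.target i) k) []
          [(6, i, j, k), (-6 * (g.factor i * g.factor k), g.target i, j, g.target k)]))
      (cond (isZero (g.factor k))
        (cond (eqb (g.target i) j) []
          [(6, i, j, k), (-6 * (g.factor i * g.factor j), g.target i, g.target j, k)]) []))

/-- Whether the generator involves the index `i`. -/
def involves (g : Generator) (i : Fin 8) : Bool := not (isZero (g.factor i))

end Generator

/-- The triples of increasing indices. -/
def triples : List (Fin 8 × Fin 8 × Fin 8) :=
  fold (fun i l => fold (fun j l => fold (fun k l =>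
    cond (ltb i j) (cond (ltb j k) ((i, j, k) :: l) l) l) l indices) l indices) [] indices

/-- Whether the indices of all terms are increasing. -/
def isSorted (L : Combination) : Bool :=
  fold (fun t b => cond (ltb t.2.1 t.2.2.1) (cond (ltb t.2.2.1 t.2.2.2) b false) false) true L

/-- Half of three times a component of `b_Θ(F)`. -/
def dualityCombination (l m n : Fin 8) : Combination :=
  addContract m n (thetaRow l) (addContract n l (thetaRow m) (addContract l m (thetaRow n) []))

/-- Two planes are linked if they are not orthogonal. -/
def linked (p q : Generator × Generator) : Bool :=
  not (isZero (pairing (planeFst q) (planeFst p)) && isZero (pairing (planeFst q) (planeSnd p))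
    && isZero (pairing (planeSnd q) (planeFst p)) && isZero (pairing (planeSnd q) (planeSnd p)))

/-! ### Verifications in components -/

section

set_option maxRecDepth 100000

theorem generators_isSkew : ∀ g ∈ generators, g.IsSkew := by
  decide +kernel

theorem generators_symmetry : (generators.all fun g => indices.all fun p =>
    (addScaled (g.factor p) (thetaRow (g.target p)) (g.act (thetaRow p))).isEmpty) = true := by
  decide +kernel

/-- Each index lies in 14 · 4 / 8 = 7 blocks, and different rows have no triple in common because a
triple lies in only one block. -/
theorem pairing_thetaRow : (indices.all fun p => indices.all fun q => isZero
    (pairing (thetaRow p) (thetaRow q) - cond (eqb p q) 7 0)) = true := by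
  decide +kernel

/-- If exactly two of i, j, k are moved by g and they lie in different planes of g, then g has
eigenvalues 0 and ±2i there, and 12 times the projection has coefficients ±6. In all other cases the
eigenvalues are 0 or ±i, which g⁴ + g² kills. -/
theorem generators_quartic : (generators.all fun g => triples.all fun t =>
    (addScaled (-1) (g.quarticTerm t.1 t.2.1 t.2.2) (g.actQuartic [(1, t)])).isEmpty) = true := by
  decide +kernel

/-- The common ±2i part is spanned by two orthogonal vectors of squared length 4, so 12 · 12 times
the projection has the coefficient 144 / 4 = 36. The inner combination is normalized first because
`comp_quartic` needs increasing indices. -/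
theorem planes_quartic : (planes.all fun p => triples.all fun t =>
    and (isSorted (addScaled 1 (p.2.quarticTerm t.1 t.2.1 t.2.2) []))
    (addScaled (-36 * coeff t.1 t.2.1 t.2.2 (planeFst p)) (planeFst p)
      (addScaled (-36 * coeff t.1 t.2.1 t.2.2 (planeSnd p)) (planeSnd p)
      (fold (fun u L => addScaled u.1 (p.1.quarticTerm u.2.1 u.2.2.1 u.2.2.2) L) []
        (addScaled 1 (p.2.quarticTerm t.1 t.2.1 t.2.2) [])))).isEmpty) = true := by
  decide +kernel

theorem planes_rotation : (planes.all fun p =>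
    and (addScaled 2 (planeSnd p) (p.1.act (planeFst p))).isEmpty
    (addScaled (-2) (planeFst p) (p.1.act (planeSnd p))).isEmpty) = true := by
  decide +kernel

/-- The constants agree with traces: 84 planes give 168 vectors of squared length 4, and 168 · 4 /
48 = 14. On the image of ι the coefficient must be 14 / 7 = 2. -/
theorem planes_frame : (triples.all fun t =>
    (fold (fun p => addScaled (coeff t.1 t.2.1 t.2.2 (planeFst p)) (planeFst p))
    (fold (fun p => addScaled (coeff t.1 t.2.1 t.2.2 (planeSnd p)) (planeSnd p))
    (fold (fun p => addScaled (2 * coeff t.1 t.2.1 t.2.2 (thetaRow p)) (thetaRow p))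
      [(-14, t)] indices) planes) planes).isEmpty) = true := by
  decide +kernel

/-- This is the contraction identity for Θ_{plmn} Θ_{pijk}, in the form (3/2) b_Θ = 1 - ιι*. -/
theorem duality_components : (triples.all fun t =>
    (fold (fun p => addScaled (coeff t.1 t.2.1 t.2.2 (thetaRow p)) (thetaRow p))
      (addScaled (-1) [(1, t)] (dualityCombination t.1 t.2.1 t.2.2)) indices).isEmpty) = true := by
  decide +kernel

/-- A plane from which all planes are reached in at most three steps. -/
def basePlane : Generator × Generator := (⟨0, 1, 2, 7, 1⟩, ⟨0, 1, 3, 4, 1⟩)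

theorem planes_connected :
    (planes.all fun p => (planes.filter (linked basePlane)).any fun q =>
      planes.any fun r => linked q r && linked r p) = true := by
  decide +kernel

/-- The two generators of a plane share exactly one pair of indices; the third generator moves only
one index of that pair. -/
theorem generators_isolate : (indices.all fun a => planes.any fun p => generators.any fun g =>
    indices.all fun i => Bool.not (Bool.xor (and (p.1.involves i) (and (p.2.involves i) (g.involves i)))
      (eqb i a))) = true := by
  decide +kernel

theorem generators_transitive : (indices.all fun a => indices.all fun b => eqb a b ||
    generators.any fun g => g.involves a && eqb (g.target a) b) = true := by
  decide +kernel

theorem generators_involutive : (generators.all fun g => indices.all fun i =>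
    and (eqb (g.target (g.target i)) i)
      (isZero (g.factor i * g.factor i - cond (g.involves i) 1 0))) = true := by
  decide +kernel

end

/-! ### Consequences of the verifications -/

theorem all_indices {f : Fin 8 → Bool} (h : indices.all f = true) (i : Fin 8) : f i = true :=
  List.all_eq_true.1 h i (mem_indices i)

theorem mem_triples : ∀ i j, i < j → ∀ k, j < k → (i, j, k) ∈ triples := by
  decide +kernel

theorem comp_thetaForm (p i j k : Fin 8) :
    comp (thetaForm p) i j k = coeff i j k (thetaRow p) := by
  rw [thetaForm_eq, comp_toForm]

theorem eval_thetaForm (p q : Fin 8) :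
    eval (thetaForm q) (thetaRow p) = if p = q then 7 else 0 := by
  have h := all_indices (all_indices pairing_thetaRow p) q
  rw [isZero_iff, cond_eqb, sub_eq_zero] at h
  rw [thetaForm_eq, eval_toForm, h]
  push_cast
  rfl

namespace Generator

theorem isSkew_of_mem {g : Generator} (hg : g ∈ generators) : g.IsSkew := generators_isSkew g hg

theorem mem_spin7 {g : Generator} (hg : g ∈ generators) : g.toMatrix ∈ spin7 :=
  toMatrix_mem_spin7 (isSkew_of_mem hg)
    (all_indices (List.all_eq_true.1 generators_symmetry g hg))

theorem target_target {g : Generator} (hg : g ∈ generators) (i : Fin 8) :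
    g.target (g.target i) = i := by
  have h := all_indices (List.all_eq_true.1 generators_involutive g hg) i
  rw [Bool.and_eq_true] at h
  exact eqb_iff.1 h.1

theorem factor_mul_self {g : Generator} (hg : g ∈ generators) (i : Fin 8) :
    g.factor i * g.factor i = if g.involves i then 1 else 0 := by
  have h := all_indices (List.all_eq_true.1 generators_involutive g hg) i
  rw [Bool.and_eq_true, isZero_iff, sub_eq_zero, Bool.cond_eq_ite] at h
  exact h.2

theorem factor_target {g : Generator} (hg : g ∈ generators) (i : Fin 8) :
    g.factor (g.target i) = -g.factor i := by
  have h := isSkew_of_mem hg (g.target i) i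
  rw [if_pos rfl, target_target hg, if_pos rfl] at h
  omega

theorem mulVec_apply {g : Generator} (hg : g ∈ generators) (v : Fin 8 → ℝ) (p : Fin 8) :
    g.toMatrix.mulVec v p = -(g.factor p * v (g.target p)) := by
  have h (i : Fin 8) : g.toMatrix p i = -(if i = g.target p then (g.factor p : ℝ) else 0) := by
    have := isSkew_of_mem hg p i
    simp only [toMatrix, Matrix.of_apply]
    exact_mod_cast this
  simp [Matrix.mulVec, dotProduct, h]

theorem mulVec_mulVec_apply {g : Generator} (hg : g ∈ generators) (v : Fin 8 → ℝ) (p : Fin 8) :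
    g.toMatrix.mulVec (g.toMatrix.mulVec v) p = if g.involves p then -v p else 0 := by
  have h : (g.factor p : ℝ) * g.factor p = if g.involves p then 1 else 0 := by
    exact_mod_cast factor_mul_self hg p
  rw [mulVec_apply hg, mulVec_apply hg, target_target hg, factor_target hg]
  push_cast
  rw [show -((g.factor p : ℝ) * -(-g.factor p * v p)) = -(g.factor p * g.factor p * v p) by ring, h]
  split_ifs <;> simp

/-- The operator `g⁴ + g²` on three-forms. -/
def quartic (g : Generator) (F : Form 8 3) : Form 8 3 :=
  ⁅g.toMatrix, ⁅g.toMatrix, ⁅g.toMatrix, ⁅g.toMatrix, F⁆⁆⁆⁆ + ⁅g.toMatrix, ⁅g.toMatrix, F⁆⁆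

theorem comp_quartic {g : Generator} (hg : g ∈ generators) (F : Form 8 3) {i j k : Fin 8}
    (hij : i < j) (hjk : j < k) : comp (g.quartic F) i j k = eval F (g.quarticTerm i j k) := by
  have h := eval_eq_zero F (List.all_eq_true.1
    (List.all_eq_true.1 generators_quartic g hg) _ (mem_triples i j hij k hjk))
  simp only [eval_addScaled, actQuartic, eval_act] at h
  simp only [eval_cons, eval_nil] at h
  push_cast at h
  rw [quartic, comp_add]
  linarith

theorem eval_quartic {g : Generator} (hg : g ∈ generators) (F : Form 8 3) {L : Combination}
    (hL : isSorted L = true) :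
    eval (g.quartic F) L
      = eval F (fold (fun u M => addScaled u.1 (g.quarticTerm u.2.1 u.2.2.1 u.2.2.2) M) [] L) := by
  induction L with
  | nil => rfl
  | cons t L ih =>
    obtain ⟨c, i, j, k⟩ := t
    have hs : isSorted ((c, i, j, k) :: L)
        = cond (ltb i j) (cond (ltb j k) (isSorted L) false) false := rfl
    simp only [hs, cond_ltb, Bool.if_false_right, Bool.and_eq_true, decide_eq_true_eq] at hL
    rw [fold_cons, eval_addScaled, eval_cons, ih hL.2.2, comp_quartic hg F hL.1 hL.2.1]

end Generator

theorem fst_mem_generators {p : Generator × Generator} (hp : p ∈ planes) :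
    p.1 ∈ generators := by
  simp only [planes, generators, List.mem_flatMap, List.mem_cons, List.not_mem_nil, or_false] at *
  obtain ⟨t, ht, rfl | rfl | rfl⟩ := hp <;> exact ⟨t, ht, by simp⟩

theorem snd_mem_generators {p : Generator × Generator} (hp : p ∈ planes) :
    p.2 ∈ generators := by
  simp only [planes, generators, List.mem_flatMap, List.mem_cons, List.not_mem_nil, or_false] at *
  obtain ⟨t, ht, rfl | rfl | rfl⟩ := hp <;> exact ⟨t, ht, by simp⟩

theorem quartic_quartic {p : Generator × Generator} (hp : p ∈ planes) (F : Form 8 3) :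
    p.2.quartic (p.1.quartic F) = (36 : ℝ) • (eval F (planeFst p) • toForm (planeFst p)
      + eval F (planeSnd p) • toForm (planeSnd p)) := by
  refine threeForm_ext fun i j hij k hjk => ?_
  have h := List.all_eq_true.1 (List.all_eq_true.1 planes_quartic p hp) _ (mem_triples i j hij k hjk)
  rw [Bool.and_eq_true] at h
  have h2 := eval_eq_zero F h.2
  rw [eval_addScaled, eval_addScaled, ← Generator.eval_quartic (fst_mem_generators hp) F h.1,
    eval_addScaled] at h2
  rw [Generator.comp_quartic (snd_mem_generators hp) _ hij hjk]
  simp only [comp_smul, comp_add, comp_toForm]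
  simp only [eval_nil] at h2
  push_cast at h2
  linarith

theorem lie_planeFst {p : Generator × Generator} (hp : p ∈ planes) :
    ⁅p.1.toMatrix, toForm (planeFst p)⁆ = (2 : ℝ) • toForm (planeSnd p) := by
  have h := List.all_eq_true.1 planes_rotation p hp
  rw [Bool.and_eq_true] at h
  rw [Generator.comp_lie_toForm (Generator.isSkew_of_mem (fst_mem_generators hp)),
    ← neg_one_smul ℝ (toForm (p.1.act _))]
  refine threeForm_ext fun i j _ k _ => ?_
  have h1 := eval_eq_zero (wedge ![i, j, k]) h.1
  rw [eval_addScaled, ← comp_toForm_eq_eval_wedge, ← comp_toForm_eq_eval_wedge] at h1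
  push_cast at h1
  rw [comp_smul, comp_smul]
  linarith

theorem lie_planeSnd {p : Generator × Generator} (hp : p ∈ planes) :
    ⁅p.1.toMatrix, toForm (planeSnd p)⁆ = (-2 : ℝ) • toForm (planeFst p) := by
  have h := List.all_eq_true.1 planes_rotation p hp
  rw [Bool.and_eq_true] at h
  rw [Generator.comp_lie_toForm (Generator.isSkew_of_mem (fst_mem_generators hp)),
    ← neg_one_smul ℝ (toForm (p.1.act _))]
  refine threeForm_ext fun i j _ k _ => ?_
  have h1 := eval_eq_zero (wedge ![i, j, k]) h.2
  rw [eval_addScaled, ← comp_toForm_eq_eval_wedge, ← comp_toForm_eq_eval_wedge] at h1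
  push_cast at h1
  rw [comp_smul, comp_smul]
  linarith

theorem frame_formula (F : Form 8 3) :
    (14 : ℝ) • F = (planes.map fun p => eval F (planeFst p) • toForm (planeFst p)).sum
      + (planes.map fun p => eval F (planeSnd p) • toForm (planeSnd p)).sum
      + (2 : ℝ) • ∑ p, eval F (thetaRow p) • thetaForm p := by
  have hsum (l : List (Generator × Generator)) (f : Generator × Generator → Combination)
      (i j k : Fin 8) : comp (l.map fun p => eval F (f p) • toForm (f p)).sum i j k
        = (l.map fun p => coeff i j k (f p) * eval F (f p)).sum := by
    induction l with
    | nil => simp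
    | cons p l ih => simp only [List.map_cons, List.sum_cons, comp_add, ih, comp_smul, comp_toForm,
        mul_comm]
  refine threeForm_ext fun i j hij k hjk => ?_
  have h := eval_eq_zero F (List.all_eq_true.1 planes_frame _ (mem_triples i j hij k hjk))
  rw [eval_fold_addScaled, eval_fold_addScaled, eval_fold_addScaled, ← sum_eq_sum_indices] at h
  simp only [comp_smul, comp_add, hsum, comp_sum, comp_thetaForm, Finset.mul_sum]
  simp only [eval_cons, eval_nil] at h
  push_cast at h
  have h2 : ∑ p, 2 * (coeff i j k (thetaRow p) : ℝ) * eval F (thetaRow p)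
      = ∑ p, 2 * (eval F (thetaRow p) * (coeff i j k (thetaRow p) : ℝ)) :=
    Finset.sum_congr rfl fun p _ => by ring
  linarith

/-! ### The duality operator in components -/

/-- The contraction is already antisymmetric in l, m, so the six permutations reduce to twice the
cyclic sum, and 2/6 = 1/3. The factor 2 on the right undoes the ½ in `addContract`. -/
theorem comp_dualityOperator (F : Form 8 3) (l m n : Fin 8) :
    3 * comp (dualityOperator Θ F) l m n = 2 * eval F (dualityCombination l m n) := by
  have hG (l m n : Fin 8) : contraction Θ F ![e l, e m, e n]
      = ∑ i, ∑ j, comp (toForm (thetaRow l)) m i j * comp F i j n := by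
    simp only [← thetaForm_eq]
    change ∑ i, ∑ j, Θ ![e i, e j, e l, e m] * F ![e i, e j, e n] = _
    simp only [Θ_swap_pairs _ _ l m]
    rfl
  have hswap (l m n : Fin 8) : contraction Θ F ![e m, e l, e n]
      = -contraction Θ F ![e l, e m, e n] := by
    change ∑ i, ∑ j, Θ ![e i, e j, e m, e l] * F ![e i, e j, e n]
      = -∑ i, ∑ j, Θ ![e i, e j, e l, e m] * F ![e i, e j, e n]
    simp only [← Finset.sum_neg_distrib]
    refine Finset.sum_congr rfl fun i _ => Finset.sum_congr rfl fun j _ => ?_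
    have : Θ ![e i, e j, e m, e l] = -Θ ![e i, e j, e l, e m] := by
      rw [← Θ.map_swap ![e i, e j, e l, e m] (i := 2) (j := 3) (by decide)]
      congr 1; ext a : 1; fin_cases a <;> rfl
    rw [this, neg_mul]
  have hperm : (Finset.univ : Finset (Equiv.Perm (Fin 3)))
      = {1, Equiv.swap 0 1, Equiv.swap 0 2, Equiv.swap 1 2, Equiv.swap 0 1 * Equiv.swap 1 2,
        Equiv.swap 1 2 * Equiv.swap 0 1} := by decide
  have hb : comp (dualityOperator Θ F) l m n = (1 / 6 : ℝ) * ∑ σ : Equiv.Perm (Fin 3),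
      (Equiv.Perm.sign σ : ℤ) * contraction Θ F (fun a => ![e l, e m, e n] (σ a)) := by
    change ((1 / 6 : ℝ) • MultilinearMap.alternatization (contraction Θ F)) _ = _
    rw [AlternatingMap.smul_apply, MultilinearMap.alternatization_apply, smul_eq_mul]
    congr 1
    refine Finset.sum_congr rfl fun σ _ => ?_
    rw [Units.smul_def, zsmul_eq_mul]
    rfl
  have v1 : (fun a => ![e l, e m, e n] ((1 : Equiv.Perm (Fin 3)) a) : Fin 3 → Fin 8 → ℝ)
      = ![e l, e m, e n] := rfl
  have v2 : (fun a => ![e l, e m, e n] ((Equiv.swap 0 1 : Equiv.Perm (Fin 3)) a) :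
      Fin 3 → Fin 8 → ℝ) = ![e m, e l, e n] := by ext a : 1; fin_cases a <;> rfl
  have v3 : (fun a => ![e l, e m, e n] ((Equiv.swap 0 2 : Equiv.Perm (Fin 3)) a) :
      Fin 3 → Fin 8 → ℝ) = ![e n, e m, e l] := by ext a : 1; fin_cases a <;> rfl
  have v4 : (fun a => ![e l, e m, e n] ((Equiv.swap 1 2 : Equiv.Perm (Fin 3)) a) :
      Fin 3 → Fin 8 → ℝ) = ![e l, e n, e m] := by ext a : 1; fin_cases a <;> rfl
  have v5 : (fun a => ![e l, e m, e n] ((Equiv.swap 0 1 * Equiv.swap 1 2 : Equiv.Perm (Fin 3)) a) :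
      Fin 3 → Fin 8 → ℝ) = ![e m, e n, e l] := by ext a : 1; fin_cases a <;> rfl
  have v6 : (fun a => ![e l, e m, e n] ((Equiv.swap 1 2 * Equiv.swap 0 1 : Equiv.Perm (Fin 3)) a) :
      Fin 3 → Fin 8 → ℝ) = ![e n, e l, e m] := by ext a : 1; fin_cases a <;> rfl
  have e1 := eval_addContract (thetaRow l) (addContract n l (thetaRow m)
    (addContract l m (thetaRow n) [])) F m n
  have e2 := eval_addContract (thetaRow m) (addContract l m (thetaRow n) []) F n l
  have e3 := eval_addContract (thetaRow n) [] F l m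
  rw [← hG] at e1 e2 e3
  rw [hb, hperm, Finset.sum_insert (by decide), Finset.sum_insert (by decide),
    Finset.sum_insert (by decide), Finset.sum_insert (by decide), Finset.sum_insert (by decide),
    Finset.sum_singleton, v1, v2, v3, v4, v5, v6, hswap l m n, hswap m n l, hswap n l m]
  simp only [Equiv.Perm.sign_mul, Equiv.Perm.sign_one,
    Equiv.Perm.sign_swap (show (0 : Fin 3) ≠ 1 by decide),
    Equiv.Perm.sign_swap (show (0 : Fin 3) ≠ 2 by decide),
    Equiv.Perm.sign_swap (show (1 : Fin 3) ≠ 2 by decide)]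
  rw [dualityCombination]
  simp only [eval_nil, mul_zero, add_zero] at e3
  push_cast
  linarith

theorem dualityOperator_eq (F : Form 8 3) :
    dualityOperator Θ F = (2 / 3 : ℝ) • F
      - (2 / 3 : ℝ) • ∑ p, eval F (thetaRow p) • thetaForm p := by
  refine threeForm_ext fun i j hij k hjk => ?_
  have h := eval_eq_zero F (List.all_eq_true.1 duality_components _ (mem_triples i j hij k hjk))
  rw [eval_fold_addScaled, ← sum_eq_sum_indices, eval_addScaled] at h
  have h1 := comp_dualityOperator F i j k
  simp only [comp_sub, comp_smul, comp_sum, comp_thetaForm]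
  simp only [eval_cons, eval_nil] at h
  push_cast at h
  have h2 : ∑ p, (coeff i j k (thetaRow p) : ℝ) * eval F (thetaRow p)
      = ∑ p, eval F (thetaRow p) * (coeff i j k (thetaRow p) : ℝ) :=
    Finset.sum_congr rfl fun p _ => mul_comm _ _
  linarith

/-! ### Equivariance -/

theorem apply_swap_of_mem_spin7 {A : Matrix (Fin 8) (Fin 8) ℝ} (hA : A ∈ spin7) (p q : Fin 8) :
    A p q = -A q p := by
  have h := (LieAlgebra.Orthogonal.mem_so _ _ A).1 hA.1
  exact congrFun (congrFun h q) p

/-- Invariance of Θ moves the action from the last three slots to the first one. -/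
theorem lie_thetaForm {A : Matrix (Fin 8) (Fin 8) ℝ} (hA : A ∈ spin7) (p : Fin 8) :
    ⁅A, thetaForm p⁆ = ∑ q, A q p • thetaForm q := by
  refine threeForm_ext fun i j _ k _ => ?_
  have h : ⁅A, Θ⁆ ![e p, e i, e j, e k] = 0 := by rw [hA.2]; rfl
  rw [lie_four_apply, mulVec_e, form_four_sum] at h
  have h2 : comp ⁅A, thetaForm p⁆ i j k = -(Θ ![e p, A.mulVec (e i), e j, e k]
      + Θ ![e p, e i, A.mulVec (e j), e k] + Θ ![e p, e i, e j, A.mulVec (e k)]) :=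
    lie_three_apply A (thetaForm p) _ _ _
  rw [h2, comp_sum]
  simp only [comp_smul]
  change _ = ∑ q, A q p * Θ ![e q, e i, e j, e k]
  linarith

theorem lie_smul_form (A : Matrix (Fin 8) (Fin 8) ℝ) (c : ℝ) (F : Form 8 3) :
    ⁅A, c • F⁆ = c • ⁅A, F⁆ :=
  lie_smul c A F

theorem sum_mul_sum_skew {A : Matrix (Fin 8) (Fin 8) ℝ} (hA : ∀ p q, A p q = -A q p)
    (f g : Fin 8 → ℝ) :
    ∑ i, f i * ∑ p, A p i * g p = -∑ i, (∑ p, A p i * f p) * g i := by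
  simp only [Finset.mul_sum, Finset.sum_mul, ← Finset.sum_neg_distrib]
  rw [Finset.sum_comm]
  refine Finset.sum_congr rfl fun i _ => Finset.sum_congr rfl fun p _ => ?_
  rw [hA i p]
  ring

theorem innerProd_lie {A : Matrix (Fin 8) (Fin 8) ℝ} (hA : ∀ p q, A p q = -A q p)
    (F G : Form 8 3) : innerProd F ⁅A, G⁆ = -innerProd ⁅A, F⁆ G := by
  have h1 : ∑ i, ∑ j, ∑ k, comp F i j k * ∑ p, A p i * comp G p j k
      = -∑ i, ∑ j, ∑ k, (∑ p, A p i * comp F p j k) * comp G i j k := by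
    have hc (H : Fin 8 → Fin 8 → Fin 8 → ℝ) :
        ∑ i, ∑ j, ∑ k, H i j k = ∑ j, ∑ k, ∑ i, H i j k := by
      rw [Finset.sum_comm]
      exact Finset.sum_congr rfl fun j _ => Finset.sum_comm
    rw [hc, hc fun i j k => (∑ p, A p i * comp F p j k) * comp G i j k]
    simp only [← Finset.sum_neg_distrib]
    exact Finset.sum_congr rfl fun j _ => Finset.sum_congr rfl fun k _ => by
      rw [sum_mul_sum_skew hA (fun i => comp F i j k) fun i => comp G i j k, Finset.sum_neg_distrib]
  have h2 : ∑ i, ∑ j, ∑ k, comp F i j k * ∑ p, A p j * comp G i p k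
      = -∑ i, ∑ j, ∑ k, (∑ p, A p j * comp F i p k) * comp G i j k := by
    rw [← Finset.sum_neg_distrib]
    refine Finset.sum_congr rfl fun i _ => ?_
    rw [Finset.sum_comm, Finset.sum_comm (f := fun j k => (∑ p, A p j * comp F i p k) * _),
      ← Finset.sum_neg_distrib]
    exact Finset.sum_congr rfl fun k _ =>
      sum_mul_sum_skew hA (fun j => comp F i j k) fun j => comp G i j k
  have h3 : ∑ i, ∑ j, ∑ k, comp F i j k * ∑ p, A p k * comp G i j p
      = -∑ i, ∑ j, ∑ k, (∑ p, A p k * comp F i j p) * comp G i j k := by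
    simp only [← Finset.sum_neg_distrib]
    exact Finset.sum_congr rfl fun i _ => Finset.sum_congr rfl fun j _ => by
      rw [sum_mul_sum_skew hA (fun k => comp F i j k) fun k => comp G i j k, Finset.sum_neg_distrib]
  simp only [innerProd, comp_lie, Finset.sum_add_distrib, mul_neg, neg_mul, mul_add, add_mul,
    Finset.sum_neg_distrib]
  linarith

/-- The adjoint of `lie_thetaForm` under the invariant inner product: the equivariance of ι*. -/
theorem eval_lie {A : Matrix (Fin 8) (Fin 8) ℝ} (hA : A ∈ spin7) (F : Form 8 3) (p : Fin 8) :
    eval ⁅A, F⁆ (thetaRow p) = -∑ q, A q p * eval F (thetaRow q) := by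
  have h := innerProd_lie (apply_swap_of_mem_spin7 hA) (thetaForm p) F
  have hs : innerProd (∑ q, A q p • thetaForm q) F = ∑ q, A q p * innerProd (thetaForm q) F := by
    let f : Form 8 3 →+ ℝ := AddMonoidHom.mk' (fun H => innerProd H F) fun H K => by
      simp only [innerProd, comp_add, add_mul, Finset.sum_add_distrib]
    have hf (c : ℝ) (H : Form 8 3) : f (c • H) = c * innerProd H F := by
      change innerProd (c • H) F = _
      simp only [innerProd, comp_smul, Finset.mul_sum, mul_assoc]
    change f _ = _
    rw [map_sum]
    exact Finset.sum_congr rfl fun q _ => hf _ _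
  rw [lie_thetaForm hA, hs] at h
  simp only [thetaForm_eq, innerProd_toForm] at h
  have : ∑ q, A q p * (6 * eval F (thetaRow q)) = 6 * ∑ q, A q p * eval F (thetaRow q) := by
    rw [Finset.mul_sum]; exact Finset.sum_congr rfl fun q _ => by ring
  linarith

theorem lie_form_sum {ι : Type*} (A : Matrix (Fin 8) (Fin 8) ℝ) (s : Finset ι)
    (F : ι → Form 8 3) : ⁅A, ∑ a ∈ s, F a⁆ = ∑ a ∈ s, ⁅A, F a⁆ :=
  map_sum (LieModule.toEnd ℝ (Matrix (Fin 8) (Fin 8) ℝ) (Form 8 3) A) F s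

/-- The embedding `v ↦ Θ(v, ⬝, ⬝, ⬝)` of `ℝ⁸` into the three-forms. -/
noncomputable def interior : (Fin 8 → ℝ) →ₗ[ℝ] Form 8 3 := Fintype.linearCombination ℝ thetaForm

theorem interior_apply (v : Fin 8 → ℝ) : interior v = ∑ p, v p • thetaForm p := rfl

theorem eval_interior (v : Fin 8 → ℝ) (p : Fin 8) : eval (interior v) (thetaRow p) = 7 * v p := by
  change evalₗ (thetaRow p) (∑ q, v q • thetaForm q) = _
  rw [map_sum]
  simp only [map_smul]
  change ∑ q, v q * eval (thetaForm q) (thetaRow p) = _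
  simp [eval_thetaForm, mul_comm]

theorem lie_interior {A : Matrix (Fin 8) (Fin 8) ℝ} (hA : A ∈ spin7) (v : Fin 8 → ℝ) :
    ⁅A, interior v⁆ = interior (A.mulVec v) := by
  simp only [interior_apply, lie_form_sum, lie_smul_form, lie_thetaForm hA]
  simp only [Matrix.mulVec, dotProduct, Finset.smul_sum, Finset.sum_smul]
  rw [Finset.sum_comm]
  exact Finset.sum_congr rfl fun p _ => Finset.sum_congr rfl fun q _ => by
    rw [smul_smul, mul_comm]

/-- The coordinates `F ↦ Θ_{pijk} F^{ijk} / 6` of the contraction of a three-form with `Θ`. -/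
def contractTheta (F : Form 8 3) : Fin 8 → ℝ := fun p => eval F (thetaRow p)

theorem contractTheta_interior (v : Fin 8 → ℝ) : contractTheta (interior v) = (7 : ℝ) • v :=
  funext fun p => eval_interior v p

theorem contractTheta_lie {A : Matrix (Fin 8) (Fin 8) ℝ} (hA : A ∈ spin7) (F : Form 8 3) :
    contractTheta ⁅A, F⁆ = A.mulVec (contractTheta F) := by
  funext p
  change eval _ _ = ∑ q, A p q * eval F (thetaRow q)
  rw [eval_lie hA, ← Finset.sum_neg_distrib]
  exact Finset.sum_congr rfl fun q _ => by rw [apply_swap_of_mem_spin7 hA p q]; ring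

theorem dualityOperator_apply (F : Form 8 3) :
    dualityOperator Θ F = (2 / 3 : ℝ) • F - (2 / 3 : ℝ) • interior (contractTheta F) :=
  dualityOperator_eq F

theorem dualityOperator_lie {A : Matrix (Fin 8) (Fin 8) ℝ} (hA : A ∈ spin7) (F : Form 8 3) :
    dualityOperator Θ ⁅A, F⁆ = ⁅A, dualityOperator Θ F⁆ := by
  rw [dualityOperator_apply, dualityOperator_apply, lie_sub, lie_smul_form, lie_smul_form,
    contractTheta_lie hA, lie_interior hA]

/-! ### Eigenspaces -/

theorem dualityOperator_mul_self : dualityOperator Θ * dualityOperator Θ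
    = (8 / 3 : ℝ) • (1 : Module.End ℝ (Form 8 3)) - (10 / 3 : ℝ) • dualityOperator Θ := by
  ext1 F
  -- From ι*ι = 7: ι*b_Θ = (2/3)(1 - 7)ι* = -4ι*.
  have h : interior (contractTheta (dualityOperator Θ F))
      = (-4 : ℝ) • interior (contractTheta F) := by
    have : contractTheta (dualityOperator Θ F) = (-4 : ℝ) • contractTheta F := by
      rw [dualityOperator_apply]
      funext p
      change evalₗ (thetaRow p) (_ - _) = -4 * eval F (thetaRow p)
      rw [map_sub, map_smul, map_smul]
      change 2 / 3 * eval F (thetaRow p) - 2 / 3 * eval (interior (contractTheta F)) (thetaRow p) = _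
      rw [eval_interior]
      change _ - 2 / 3 * (7 * eval F (thetaRow p)) = _
      ring
    rw [this, map_smul]
  rw [Module.End.mul_apply, dualityOperator_apply (dualityOperator Θ F), h]
  simp only [LinearMap.sub_apply, LinearMap.smul_apply, Module.End.one_apply]
  rw [dualityOperator_apply]
  module

/-- The eigenspaces of the duality operator of `Θ` as `𝔰𝔭𝔦𝔫(7)`-modules. -/
noncomputable def eigenModule (β : ℝ) : LieSubmodule ℝ spin7 (Form 8 3) :=
  { (dualityOperator Θ).eigenspace β with
    lie_mem := by
      intro A F hF
      change ⁅(A : Matrix (Fin 8) (Fin 8) ℝ), F⁆ ∈ (dualityOperator Θ).eigenspace β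
      have hF' : F ∈ (dualityOperator Θ).eigenspace β := hF
      rw [Module.End.mem_eigenspace_iff] at hF' ⊢
      rw [dualityOperator_lie A.2, hF', lie_smul] }

theorem mem_eigenModule {β : ℝ} {F : Form 8 3} :
    F ∈ eigenModule β ↔ dualityOperator Θ F = β • F :=
  Module.End.mem_eigenspace_iff

theorem eigenModule_toSubmodule (β : ℝ) :
    (eigenModule β).toSubmodule = (dualityOperator Θ).eigenspace β := rfl

theorem interior_injective : Function.Injective interior := fun v w h => by
  have := congrArg contractTheta h
  rw [contractTheta_interior, contractTheta_interior] at this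
  exact smul_right_injective _ (by norm_num : (7 : ℝ) ≠ 0) this

theorem mem_eigenModule_eight {F : Form 8 3} :
    F ∈ eigenModule (-4) ↔ F = interior ((1 / 7 : ℝ) • contractTheta F) := by
  rw [mem_eigenModule, dualityOperator_apply, map_smul]
  constructor
  · intro h
    have h2 : (2 / 3 : ℝ) • interior (contractTheta F) = (2 / 3 : ℝ) • F - (-4 : ℝ) • F := by
      rw [← h]; abel
    have h3 : interior (contractTheta F) = (3 / 2 : ℝ) • ((2 / 3 : ℝ) • F - (-4 : ℝ) • F) := by
      rw [← h2]; module
    rw [h3]; module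
  · intro h
    have h3 : interior (contractTheta F) = (7 : ℝ) • F := by
      nth_rw 2 [h]; module
    rw [h3]; module

theorem interior_mem (v : Fin 8 → ℝ) : interior v ∈ eigenModule (-4) := by
  rw [mem_eigenModule_eight, contractTheta_interior, smul_smul]
  norm_num

theorem mem_eigenModule_fortyEight {F : Form 8 3} :
    F ∈ eigenModule (2 / 3) ↔ contractTheta F = 0 := by
  rw [mem_eigenModule, dualityOperator_apply]
  constructor
  · intro h
    have h2 : interior (contractTheta F) = 0 := by
      have := sub_eq_self.1 h
      exact (smul_eq_zero.1 this).resolve_left (by norm_num)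
    exact interior_injective (by rw [h2, map_zero])
  · intro h
    rw [h, map_zero]; simp

theorem isCompl_eigenModule : IsCompl (eigenModule (-4)) (eigenModule (2 / 3)) := by
  constructor
  · rw [disjoint_iff, eq_bot_iff]
    intro F hF
    rw [LieSubmodule.mem_inf, mem_eigenModule_eight, mem_eigenModule_fortyEight] at hF
    rw [hF.2, smul_zero, map_zero] at hF
    exact (LieSubmodule.mem_bot F).2 hF.1
  · rw [codisjoint_iff, eq_top_iff]
    intro F _
    rw [LieSubmodule.mem_sup]
    -- Since ι*ι = 7, the map ιι*/7 is the projection to the image of ι along the kernel of ι*.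
    refine ⟨interior ((1 / 7 : ℝ) • contractTheta F), interior_mem _,
      F - interior ((1 / 7 : ℝ) • contractTheta F), ?_, by abel⟩
    rw [mem_eigenModule_fortyEight]
    funext p
    change evalₗ (thetaRow p) (_ - _) = 0
    rw [map_sub]
    change eval F _ - eval (interior _) _ = 0
    rw [eval_interior]
    change eval F (thetaRow p) - 7 * (1 / 7 * eval F (thetaRow p)) = 0
    ring

noncomputable instance : Module.Finite ℝ (Form 8 3) :=
  Module.Finite.equiv
    (exteriorPower.alternatingMapLinearEquiv (R := ℝ) (n := 3) (M := Fin 8 → ℝ) (N := ℝ)).symm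

theorem finrank_threeForm : Module.finrank ℝ (Form 8 3) = 56 := by
  rw [(exteriorPower.alternatingMapLinearEquiv (R := ℝ) (n := 3) (M := Fin 8 → ℝ)
    (N := ℝ)).finrank_eq]
  change Module.finrank ℝ (Module.Dual ℝ _) = 56
  rw [Subspace.dual_finrank_eq, exteriorPower.finrank_eq, Module.finrank_fin_fun]
  rfl

theorem finrank_eigenModule_eight : Module.finrank ℝ (eigenModule (-4)) = 8 := by
  have h : (eigenModule (-4)).toSubmodule = LinearMap.range interior := by
    ext F
    rw [LieSubmodule.mem_toSubmodule, LinearMap.mem_range]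
    exact ⟨fun h => ⟨_, (mem_eigenModule_eight.1 h).symm⟩, fun ⟨v, hv⟩ => hv ▸ interior_mem v⟩
  change Module.finrank ℝ (eigenModule (-4)).toSubmodule = 8
  rw [h, LinearMap.finrank_range_of_inj interior_injective, Module.finrank_fin_fun]

theorem finrank_eigenModule_fortyEight : Module.finrank ℝ (eigenModule (2 / 3)) = 48 := by
  have h := Submodule.finrank_add_eq_of_isCompl
    (LieSubmodule.isCompl_toSubmodule.2 isCompl_eigenModule)
  rw [finrank_threeForm] at h
  have h8 : Module.finrank ℝ (eigenModule (-4)).toSubmodule = 8 := finrank_eigenModule_eight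
  change Module.finrank ℝ (eigenModule (2 / 3)).toSubmodule = 48
  omega

theorem hasEigenvalue_iff (β : ℝ) :
    (dualityOperator Θ).HasEigenvalue β ↔ β = -4 ∨ β = 2 / 3 := by
  constructor
  · intro h
    obtain ⟨F, hF⟩ := h.exists_hasEigenvector
    have h1 := hF.apply_eq_smul
    have h2 := LinearMap.congr_fun dualityOperator_mul_self F
    simp only [Module.End.mul_apply, LinearMap.sub_apply, LinearMap.smul_apply,
      Module.End.one_apply, h1, map_smul] at h2
    have h3 : ((β + 4) * (β - 2 / 3)) • F = 0 := by
      have : ((β + 4) * (β - 2 / 3)) • F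
          = β • β • F - ((8 / 3 : ℝ) • F - (10 / 3 : ℝ) • β • F) := by module
      rw [this, h2, sub_self]
    rcases mul_eq_zero.1 ((smul_eq_zero.1 h3).resolve_right hF.2) with h | h
    · left; linarith
    · right; linarith
  · rintro (rfl | rfl) h
    · have := finrank_eigenModule_eight
      rw [show eigenModule (-4) = ⊥ from LieSubmodule.toSubmodule_injective h] at this
      have h0 : Module.finrank ℝ (⊥ : Submodule ℝ (Form 8 3)) = 8 := this
      simp at h0
    · have := finrank_eigenModule_fortyEight
      rw [show eigenModule (2 / 3) = ⊥ from LieSubmodule.toSubmodule_injective h] at this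
      have h0 : Module.finrank ℝ (⊥ : Submodule ℝ (Form 8 3)) = 48 := this
      simp at h0

/-! ### Irreducibility -/

/-- A submodule is irreducible if and only if it is minimal among the nonzero submodules. -/
theorem isIrreducible_iff_isAtom {R L M : Type*} [CommRing R] [LieRing L] [AddCommGroup M]
    [Module R M] [LieRingModule L M] (W : LieSubmodule R L M) :
    LieModule.IsIrreducible R L W ↔ IsAtom W := by
  constructor
  · intro h
    have hW : W ≠ ⊥ := (LieSubmodule.nontrivial_iff_ne_bot R L M).1
      (LieModule.nontrivial_of_isIrreducible R L W)
    refine ⟨hW, fun U hU => ?_⟩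
    rcases IsSimpleOrder.eq_bot_or_eq_top (U.comap W.incl) with h1 | h1
    · rw [LieSubmodule.comap_incl_eq_bot, inf_eq_right.2 hU.le] at h1
      exact h1
    · exact absurd (LieSubmodule.comap_incl_eq_top.1 h1) hU.not_ge
  · intro h
    have : Nontrivial W := (LieSubmodule.nontrivial_iff_ne_bot R L M).2 h.1
    refine LieModule.IsIrreducible.mk fun N hN => ?_
    have hle : N.map W.incl ≤ W := LieSubmodule.map_incl_le
    rcases h.le_iff.1 hle with h1 | h1
    · refine absurd ?_ hN
      rw [eq_bot_iff]
      intro x hx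
      have h2 : (x : M) ∈ N.map W.incl := LieSubmodule.mem_map_of_mem (f := W.incl) hx
      rw [h1, LieSubmodule.mem_bot] at h2
      rw [LieSubmodule.mem_bot]
      exact Subtype.ext h2
    · rw [eq_top_iff]
      intro x _
      have h2 : (x : M) ∈ N.map W.incl := by rw [h1]; exact x.2
      obtain ⟨y, hy, hxy⟩ := (LieSubmodule.mem_map _).1 h2
      have : y = x := Subtype.ext hxy
      exact this ▸ hy

theorem lie_mem_of_mem_spin7 (U : LieSubmodule ℝ spin7 (Form 8 3))
    {A : Matrix (Fin 8) (Fin 8) ℝ} (hA : A ∈ spin7) {F : Form 8 3} (hF : F ∈ U) : ⁅A, F⁆ ∈ U :=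
  U.lie_mem (x := (⟨A, hA⟩ : spin7)) hF

theorem quartic_mem (U : LieSubmodule ℝ spin7 (Form 8 3)) {g : Generator} (hg : g ∈ generators)
    {F : Form 8 3} (hF : F ∈ U) : g.quartic F ∈ U := by
  have h {G : Form 8 3} (hG : G ∈ U) := lie_mem_of_mem_spin7 U (Generator.mem_spin7 hg) hG
  exact add_mem (h (h (h (h hF)))) (h (h hF))

/-! #### The eight-dimensional submodule -/

/-- Squares of generators act as minus coordinate projections, so three of them with a single common
index cut `v` down to its component along `e a`. -/
theorem interior_e_mem (U : LieSubmodule ℝ spin7 (Form 8 3)) {v : Fin 8 → ℝ}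
    (hv : interior v ∈ U) {a : Fin 8} (ha : v a ≠ 0) : interior (e a) ∈ U := by
  obtain ⟨p, hp, h⟩ := List.any_eq_true.1 (all_indices generators_isolate a)
  obtain ⟨g, hg, h⟩ := List.any_eq_true.1 h
  have hsq {g : Generator} (hg : g ∈ generators) {w : Fin 8 → ℝ} (hw : interior w ∈ U) :
      interior (g.toMatrix.mulVec (g.toMatrix.mulVec w)) ∈ U := by
    have hA := Generator.mem_spin7 hg
    rw [← lie_interior hA, ← lie_interior hA]
    exact lie_mem_of_mem_spin7 U hA (lie_mem_of_mem_spin7 U hA hw)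
  have h3 := hsq (fst_mem_generators hp) (hsq (snd_mem_generators hp) (hsq hg hv))
  set w := p.1.toMatrix.mulVec (p.1.toMatrix.mulVec (p.2.toMatrix.mulVec (p.2.toMatrix.mulVec
    (g.toMatrix.mulVec (g.toMatrix.mulVec v))))) with hw
  -- The sign is (-1)³, one factor from each square.
  have h4 : w = -v a • e a := by
    funext i
    have hi := all_indices h i
    have hx : (p.1.involves i && (p.2.involves i && g.involves i)) = eqb i a := by
      revert hi
      cases eqb i a <;> cases p.1.involves i <;> cases p.2.involves i <;> cases g.involves i <;>
        simp
    rw [hw, Generator.mulVec_mulVec_apply (fst_mem_generators hp),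
      Generator.mulVec_mulVec_apply (snd_mem_generators hp), Generator.mulVec_mulVec_apply hg,
      Pi.smul_apply, e_apply, smul_eq_mul, mul_ite, mul_one, mul_zero]
    by_cases hia : i = a
    · rw [eqb_iff.2 hia, Bool.and_eq_true, Bool.and_eq_true] at hx
      subst hia
      simp [hx]
    · rw [if_neg (Ne.symm hia)]
      have : eqb i a = false := Bool.eq_false_iff.2 fun h => hia (eqb_iff.1 h)
      rw [this] at hx
      revert hx
      cases p.1.involves i <;> cases p.2.involves i <;> cases g.involves i <;> simp
  rw [h4, map_smul] at h3
  exact (U.toSubmodule.smul_mem_iff (neg_ne_zero.2 ha)).1 h3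

theorem interior_e_mem_of_mem (U : LieSubmodule ℝ spin7 (Form 8 3)) {a : Fin 8}
    (ha : interior (e a) ∈ U) (b : Fin 8) : interior (e b) ∈ U := by
  have h := all_indices (all_indices generators_transitive a) b
  rw [Bool.or_eq_true] at h
  rcases h with h | h
  · rwa [← eqb_iff.1 h]
  · obtain ⟨g, hg, h⟩ := List.any_eq_true.1 h
    rw [Bool.and_eq_true, eqb_iff] at h
    have h1 := lie_mem_of_mem_spin7 U (Generator.mem_spin7 hg) ha
    rw [lie_interior (Generator.mem_spin7 hg), Generator.mulVec_e, map_smul, h.2] at h1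
    refine (U.toSubmodule.smul_mem_iff fun h0 => ?_).1 h1
    have h2 := h.1
    have h0' : g.factor a = 0 := by exact_mod_cast h0
    rw [Generator.involves, isZero_iff.2 h0'] at h2
    exact absurd h2 (by decide)

theorem isAtom_eigenModule_eight : IsAtom (eigenModule (-4)) := by
  refine ⟨fun h => ?_, fun U hU => ?_⟩
  · have h0 : Module.finrank ℝ (⊥ : Submodule ℝ (Form 8 3)) = 8 := by
      have := finrank_eigenModule_eight
      rwa [h] at this
    simp at h0
  · by_contra hne
    obtain ⟨F, hF, hF0⟩ := Submodule.exists_mem_ne_zero_of_ne_bot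
      fun h => hne (LieSubmodule.toSubmodule_injective h)
    have h1 := mem_eigenModule_eight.1 (hU.le hF)
    set v := (1 / 7 : ℝ) • contractTheta F
    obtain ⟨a, ha⟩ : ∃ a, v a ≠ 0 := by
      by_contra! hv
      exact hF0 (by rw [h1, show v = 0 from funext hv, map_zero])
    have h2 := interior_e_mem_of_mem U (interior_e_mem U (h1 ▸ hF) ha)
    refine hU.not_ge fun G hG => ?_
    rw [mem_eigenModule_eight.1 hG]
    set w := (1 / 7 : ℝ) • contractTheta G
    have hw : w = ∑ b, w b • (e b : Fin 8 → ℝ) := by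
      funext i; simp [Finset.sum_apply, Pi.single_apply]
    rw [hw, map_sum]
    exact U.toSubmodule.sum_mem fun b _ => by
      rw [map_smul]; exact U.toSubmodule.smul_mem _ (h2 b)

/-! #### The forty-eight-dimensional submodule -/

/-- The plane of a pair of generators is contained in a submodule. -/
def PlaneMem (U : LieSubmodule ℝ spin7 (Form 8 3)) (p : Generator × Generator) : Prop :=
  toForm (planeFst p) ∈ U ∧ toForm (planeSnd p) ∈ U

/-- The projection of `F` to the plane lies in `U` and is nonzero. Together with its image under the
rotation it spans the plane. -/
theorem planeMem_of_eval_ne_zero (U : LieSubmodule ℝ spin7 (Form 8 3))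
    {p : Generator × Generator} (hp : p ∈ planes) {F : Form 8 3} (hF : F ∈ U)
    (h : eval F (planeFst p) ≠ 0 ∨ eval F (planeSnd p) ≠ 0) : PlaneMem U p := by
  have hA := Generator.mem_spin7 (fst_mem_generators hp)
  have h1 : p.2.quartic (p.1.quartic F) ∈ U :=
    quartic_mem U (snd_mem_generators hp) (quartic_mem U (fst_mem_generators hp) hF)
  rw [quartic_quartic hp] at h1
  have h2 := (U.toSubmodule.smul_mem_iff (by norm_num : (36 : ℝ) ≠ 0)).1 h1
  set a := eval F (planeFst p)
  set b := eval F (planeSnd p)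
  set x := toForm (planeFst p) with hx
  set y := toForm (planeSnd p) with hy
  have h3 : a • y - b • x ∈ U := by
    have := lie_mem_of_mem_spin7 U hA h2
    rw [lie_add, lie_smul_form, lie_smul_form, lie_planeFst hp, lie_planeSnd hp] at this
    have h4 := U.toSubmodule.smul_mem (1 / 2 : ℝ) this
    have h5 : (1 / 2 : ℝ) • (a • (2 : ℝ) • y + b • (-2 : ℝ) • x) = a • y - b • x := by module
    rw [← hx, ← hy, h5] at h4
    exact h4
  -- The determinant of the passage from x, y to ax + by, ay - bx; solving for x and y divides by
  -- it.
  have hne : a ^ 2 + b ^ 2 ≠ 0 := by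
    rcases h with h | h
    · have := sq_pos_of_ne_zero h; positivity
    · have := sq_pos_of_ne_zero h; positivity
  constructor
  · refine (U.toSubmodule.smul_mem_iff hne).1 ?_
    have := U.toSubmodule.sub_mem (U.toSubmodule.smul_mem a h2) (U.toSubmodule.smul_mem b h3)
    convert this using 1
    module
  · refine (U.toSubmodule.smul_mem_iff hne).1 ?_
    have := U.toSubmodule.add_mem (U.toSubmodule.smul_mem b h2) (U.toSubmodule.smul_mem a h3)
    convert this using 1
    module

theorem pairing_comm (L M : Combination) : pairing L M = pairing M L := by
  have h : innerProd (toForm L) (toForm M) = innerProd (toForm M) (toForm L) := by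
    simp only [innerProd, mul_comm]
  rw [innerProd_toForm, innerProd_toForm, eval_toForm, eval_toForm] at h
  have h2 : (pairing L M : ℝ) = pairing M L := by linarith
  exact_mod_cast h2

theorem linked_iff {p q : Generator × Generator} : linked p q = true ↔
    pairing (planeFst q) (planeFst p) ≠ 0 ∨ pairing (planeFst q) (planeSnd p) ≠ 0 ∨
      pairing (planeSnd q) (planeFst p) ≠ 0 ∨ pairing (planeSnd q) (planeSnd p) ≠ 0 := by
  have h (c : ℤ) : isZero c = false ↔ c ≠ 0 := by rw [← Bool.not_eq_true, isZero_iff]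
  simp only [linked, Bool.not_eq_true', Bool.and_eq_false_iff, h, or_assoc]

theorem linked_comm {p q : Generator × Generator} : linked p q = true ↔ linked q p = true := by
  rw [linked_iff, linked_iff, pairing_comm (planeFst q), pairing_comm (planeFst q),
    pairing_comm (planeSnd q), pairing_comm (planeSnd q)]
  tauto

/-- Some basis vector of the first plane is not orthogonal to the second plane, so its projection
there is nonzero. -/
theorem PlaneMem.of_linked {U : LieSubmodule ℝ spin7 (Form 8 3)} {p q : Generator × Generator}
    (hp : PlaneMem U p) (hq : q ∈ planes) (h : linked p q = true) : PlaneMem U q := by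
  rw [linked_iff] at h
  have key (L M : Combination) (hLM : pairing L M ≠ 0) : eval (toForm M) L ≠ 0 := by
    rw [eval_toForm]; exact_mod_cast hLM
  rcases h with h | h | h | h
  · exact planeMem_of_eval_ne_zero U hq hp.1 (.inl (key _ _ h))
  · exact planeMem_of_eval_ne_zero U hq hp.2 (.inl (key _ _ h))
  · exact planeMem_of_eval_ne_zero U hq hp.1 (.inr (key _ _ h))
  · exact planeMem_of_eval_ne_zero U hq hp.2 (.inr (key _ _ h))

theorem basePlane_mem : basePlane ∈ planes := by
  simp [planes, stars, basePlane]

/-- Linkage is symmetric, so the path of three links can be followed in both directions. -/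
theorem PlaneMem.iff_base (U : LieSubmodule ℝ spin7 (Form 8 3)) {p : Generator × Generator}
    (hp : p ∈ planes) : PlaneMem U p ↔ PlaneMem U basePlane := by
  obtain ⟨q, hq, h⟩ := List.any_eq_true.1 (List.all_eq_true.1 planes_connected p hp)
  obtain ⟨r, hr, h⟩ := List.any_eq_true.1 h
  rw [Bool.and_eq_true] at h
  rw [List.mem_filter] at hq
  exact ⟨fun hU => ((hU.of_linked hr (linked_comm.1 h.2)).of_linked hq.1
      (linked_comm.1 h.1)).of_linked basePlane_mem (linked_comm.1 hq.2),
    fun hU => ((hU.of_linked hq.1 hq.2).of_linked hr h.1).of_linked hp h.2⟩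

theorem isAtom_eigenModule_fortyEight : IsAtom (eigenModule (2 / 3)) := by
  refine ⟨fun h => ?_, fun U hU => ?_⟩
  · have h0 : Module.finrank ℝ (⊥ : Submodule ℝ (Form 8 3)) = 48 := by
      have := finrank_eigenModule_fortyEight
      rwa [h] at this
    simp at h0
  · by_contra hne
    -- On this eigenspace ι* vanishes, and the frame formula involves the planes only.
    have frame {F : Form 8 3} (hF : F ∈ eigenModule (2 / 3)) :
        (14 : ℝ) • F = (planes.map fun p => eval F (planeFst p) • toForm (planeFst p)).sum
          + (planes.map fun p => eval F (planeSnd p) • toForm (planeSnd p)).sum := by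
      have h0 (p : Fin 8) : eval F (thetaRow p) = 0 :=
        congrFun (mem_eigenModule_fortyEight.1 hF) p
      rw [frame_formula]
      simp [h0]
    obtain ⟨F, hF, hF0⟩ := Submodule.exists_mem_ne_zero_of_ne_bot
      fun h => hne (LieSubmodule.toSubmodule_injective h)
    obtain ⟨p, hp, h⟩ : ∃ p ∈ planes, eval F (planeFst p) ≠ 0 ∨ eval F (planeSnd p) ≠ 0 := by
      by_contra! h0
      have h1 := frame (hU.le hF)
      have h2 : (planes.map fun p => eval F (planeFst p) • toForm (planeFst p)).sum = 0 := by
        refine List.sum_eq_zero fun x hx => ?_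
        obtain ⟨p, hp, rfl⟩ := List.mem_map.1 hx
        rw [(h0 p hp).1, zero_smul]
      have h3 : (planes.map fun p => eval F (planeSnd p) • toForm (planeSnd p)).sum = 0 := by
        refine List.sum_eq_zero fun x hx => ?_
        obtain ⟨p, hp, rfl⟩ := List.mem_map.1 hx
        rw [(h0 p hp).2, zero_smul]
      rw [h2, h3, add_zero] at h1
      exact hF0 ((smul_eq_zero.1 h1).resolve_left (by norm_num))
    have hall {q : Generator × Generator} (hq : q ∈ planes) : PlaneMem U q :=
      (PlaneMem.iff_base U hq).2
        ((PlaneMem.iff_base U hp).1 (planeMem_of_eval_ne_zero U hp hF h))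
    refine hU.not_ge fun G hG => ?_
    refine (U.toSubmodule.smul_mem_iff (by norm_num : (14 : ℝ) ≠ 0)).1 ?_
    rw [frame hG]
    refine U.toSubmodule.add_mem (U.toSubmodule.list_sum_mem ?_) (U.toSubmodule.list_sum_mem ?_)
    · intro x hx
      obtain ⟨q, hq, rfl⟩ := List.mem_map.1 hx
      exact U.toSubmodule.smul_mem _ (hall hq).1
    · intro x hx
      obtain ⟨q, hq, rfl⟩ := List.mem_map.1 hx
      exact U.toSubmodule.smul_mem _ (hall hq).2

/-! ### The decomposition -/

/-- If a module is the sum of two complementary minimal submodules of different dimensions, there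
are no other minimal submodules. -/
theorem isAtom_iff_of_isCompl {W₁ W₂ : LieSubmodule ℝ spin7 (Form 8 3)} (h : IsCompl W₁ W₂)
    (h₁ : IsAtom W₁) (h₂ : IsAtom W₂) (hlt : Module.finrank ℝ W₁ < Module.finrank ℝ W₂)
    (W : LieSubmodule ℝ spin7 (Form 8 3)) : IsAtom W ↔ W = W₁ ∨ W = W₂ := by
  refine ⟨fun hW => ?_, by rintro (rfl | rfl) <;> assumption⟩
  by_contra! hne
  have d₁ : Disjoint W W₁ := hW.disjoint_of_ne h₁ hne.1
  have d₂ : Disjoint W W₂ := hW.disjoint_of_ne h₂ hne.2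
  have s : Module.finrank ℝ W₁.toSubmodule + Module.finrank ℝ W₂.toSubmodule
      = Module.finrank ℝ (Form 8 3) :=
    Submodule.finrank_add_eq_of_isCompl (LieSubmodule.isCompl_toSubmodule.2 h)
  have s₂ : Module.finrank ℝ W.toSubmodule + Module.finrank ℝ W₂.toSubmodule
      ≤ Module.finrank ℝ (Form 8 3) :=
    Submodule.finrank_add_finrank_le_of_disjoint (LieSubmodule.disjoint_toSubmodule.2 d₂)
  -- Being disjoint from `W₂`, `W` is no larger than the complement `W₁`.
  have hW1 : Module.finrank ℝ W.toSubmodule ≤ Module.finrank ℝ W₁.toSubmodule := by omega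
  have htop : W ⊔ W₁ = ⊤ := by
    -- Otherwise the minimal `W₂` would be disjoint from `W ⊔ W₁`, whose dimension exceeds that of
    -- the complement `W₁`.
    have hm : W₂ ≤ W ⊔ W₁ := by
      by_contra hle
      have hd : Disjoint (W ⊔ W₁) W₂ := by
        exact (h₂.not_le_iff_disjoint.1 hle).symm
      have s₃ := Submodule.finrank_add_finrank_le_of_disjoint
        (LieSubmodule.disjoint_toSubmodule.2 hd)
      have hl : W₁ < W ⊔ W₁ := by
        refine lt_of_le_of_ne le_sup_right fun heq => ?_
        have : W ≤ W₁ := heq ▸ le_sup_left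
        exact hW.1 (d₁.eq_bot_of_le this)
      have s₄ : Module.finrank ℝ W₁.toSubmodule < Module.finrank ℝ (W ⊔ W₁).toSubmodule :=
        Submodule.finrank_lt_finrank_of_lt
          (lt_of_le_of_ne hl.le fun h => hl.ne (LieSubmodule.toSubmodule_injective h))
      omega
    rw [eq_top_iff, ← h.sup_eq_top]
    exact sup_le le_sup_right hm
  -- Now `W` and `W₂` are both complements of `W₁`, so their dimensions agree; this contradicts
  -- `hW1` and `hlt`.
  have s₃ : Module.finrank ℝ W.toSubmodule + Module.finrank ℝ W₁.toSubmodule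
      = Module.finrank ℝ (Form 8 3) := Submodule.finrank_add_eq_of_isCompl
    (LieSubmodule.isCompl_toSubmodule.2 ⟨d₁, codisjoint_iff.2 htop⟩)
  have hlt' : Module.finrank ℝ W₁.toSubmodule < Module.finrank ℝ W₂.toSubmodule := hlt
  omega

theorem isOfOrder_two : IsOfOrder Θ 2 := by
  have : {β : ℝ | (dualityOperator Θ).HasEigenvalue β} = {-4, 2 / 3} := by
    ext β
    simp [hasEigenvalue_iff]
  rw [IsOfOrder, this, Set.ncard_pair (by norm_num)]

theorem hasIrreducibleDecomposition_two : HasIrreducibleDecomposition spin7 3 2 := by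
  refine ⟨![eigenModule (-4), eigenModule (2 / 3)], fun α => ?_, ?_⟩
  · rw [isIrreducible_iff_isAtom]
    fin_cases α
    · exact isAtom_eigenModule_eight
    · exact isAtom_eigenModule_fortyEight
  · rw [DirectSum.isInternal_submodule_iff_isCompl _ (i := 0) (j := 1) (by decide)
      (by ext α; fin_cases α <;> simp)]
    exact LieSubmodule.isCompl_toSubmodule.2 isCompl_eigenModule

theorem isPerfect_Θ : IsPerfect spin7 Θ where
  le_so := fun _ hA => hA.1
  invariant := fun _ hA => hA.2
  order := ⟨2, isOfOrder_two, hasIrreducibleDecomposition_two⟩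

end SpinSevenDuality

open SpinSevenDuality in
theorem proposition3p2 :
    -- the quadratic relation
    dualityOperator Θ * dualityOperator Θ
        = (8 / 3 : ℝ) • (1 : Module.End ℝ (Form 8 3)) - (10 / 3 : ℝ) • dualityOperator Θ ∧
    -- perfect, of order two
    IsPerfect spin7 Θ ∧ IsOfOrder Θ 2 ∧
    -- the eigenvalues are exactly `-4` and `2/3`
    (∀ β : ℝ, (dualityOperator Θ).HasEigenvalue β ↔ β = -4 ∨ β = 2 / 3) ∧
    -- the eigenspaces are the two irreducible `𝔰𝔭𝔦𝔫(7)`-submodules, of dimensions `8` and `48`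
    ∃ W₈ W₄₈ : LieSubmodule ℝ spin7 (Form 8 3),
      W₈.toSubmodule = (dualityOperator Θ).eigenspace (-4) ∧
      W₄₈.toSubmodule = (dualityOperator Θ).eigenspace (2 / 3) ∧
      Module.finrank ℝ W₈ = 8 ∧ Module.finrank ℝ W₄₈ = 48 ∧
      IsCompl W₈ W₄₈ ∧
      ∀ W : LieSubmodule ℝ spin7 (Form 8 3),
        LieModule.IsIrreducible ℝ spin7 W ↔ W = W₈ ∨ W = W₄₈ := by
  refine ⟨dualityOperator_mul_self, isPerfect_Θ, isOfOrder_two, hasEigenvalue_iff,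
    eigenModule (-4), eigenModule (2 / 3), eigenModule_toSubmodule _, eigenModule_toSubmodule _,
    finrank_eigenModule_eight, finrank_eigenModule_fortyEight, isCompl_eigenModule, fun W => ?_⟩
  rw [isIrreducible_iff_isAtom]
  refine isAtom_iff_of_isCompl isCompl_eigenModule isAtom_eigenModule_eight
    isAtom_eigenModule_fortyEight ?_ W
  rw [finrank_eigenModule_eight, finrank_eigenModule_fortyEight]
  norm_num
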